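/- For a permutation $\sigma$ of a finite set $\Omega$ with $|\Omega|=n$, let its cycle type be the monomial $\operatorname{CT}(\sigma)=x_1^{k_1}x_2^{k_2}\cdots x_n^{k_n}$, where $k_i$ is the number of cycles of $\sigma$ of length $i$ (fixed points are cycles of length $1$). For a permutation group $G\leq\operatorname{Sym}(\Omega)$, its cycle index is $\operatorname{CI}(G)=\frac{1}{|G|}\sum_{\sigma\in G}\operatorname{CT}(\sigma)$, a polynomial over $\mathbb{Q}$. For an additively written group $A$, let $\operatorname{Hol}(A)\leq\operatorname{Sym}(A)$ be the holomorph of $A$, that is, the group of all maps $x\mapsto\alpha(x)+b$ with $\alpha\in\operatorname{Aut}(A)$ and $b\in A$. Let $\phi$ denote Euler's totient function. Then the following hold. 1. For every odd prime $p$ and every integer $k\geq1$, the cycle index of $\operatorname{Hol}(\mathbb{Z}/p^k\mathbb{Z})$ is $$ \begin{aligned} \frac{1}{p^{2k-1}(p-1)}\Biggl(&\sum_{w=1}^{k}p^{2w-2}(p-1)\,x_{p^w}^{p^{k-w}} +\sum_{w=0}^{k-1}\phi(p^w)\,p^w\,x_1^{p^{k-w}}\prod_{u=1}^{w}x_{p^u}^{p^{k-w-1}(p-1)}\\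 &+\sum_{w=0}^{k-1}\ \sum_{\substack{l\mid p-1\\ l>1}}p^k\,\phi(p^w)\,\phi(l)\,x_1\,x_l^{\frac{p^{k-w}-1}{l}}\prod_{u=1}^{w}x_{l p^u}^{\frac{p^{k-1-w}(p-1)}{l}}\Biggr). \end{aligned} $$ 2. The cycle index of $\operatorname{Hol}(\mathbb{Z}/2\mathbb{Z})$ is $\frac12x_1^2+\frac12x_2$. 3. The cycle index of $\operatorname{Hol}(\mathbb{Z}/4\mathbb{Z})$ is $\frac18x_1^4+\frac14x_1^2x_2+\frac38x_2^2+\frac14x_4$. 4. For every integer $k\geq3$, the cycle index of $\operatorname{Hol}(\mathbb{Z}/2^k\mathbb{Z})$ is $$ \begin{aligned} \frac{1}{2^{2k-1}}\Biggl(&2^{2k-3}x_{2^k}+\sum_{w=1}^{k-1}\bigl(2^{2w-2}+\phi(2^{w-1})2^{k-1}\bigr)x_{2^w}^{2^{k-w}} +\sum_{w=0}^{k-2}\phi(2^w)\,2^w\,x_1^{2^{k-w}}\prod_{u=1}^{w}x_{2^u}^{2^{k-1-w}}\\ &+2^kx_1^2x_2^{2^{k-1}-1}+\sum_{w=2}^{k-2}2^{k+w-2}\,x_1^2\,x_2^{2^{k-w}-1}\prod_{u=2}^{w}x_{2^u}^{2^{k-1-w}}\Biggr).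 \end{aligned} $$ Empty sums are $0$ and empty products are $1$. -/

import Mathlib

open MvPolynomial

/-- The holomorph of an additively written group `A`, as a permutation group on `A`: all maps
`x ↦ α x + b` with `α` an automorphism of `A` and `b` an element of `A`. -/
def holomorph (A : Type*) [AddGroup A] : Subgroup (Equiv.Perm A) where
  carrier := {σ | ∃ (α : A ≃+ A) (b : A), ∀ x, σ x = α x + b}
  one_mem' := ⟨AddEquiv.refl A, 0, fun x => by simp⟩
  mul_mem' := by
    rintro σ τ ⟨α, b, hσ⟩ ⟨β, c, hτ⟩
    exact ⟨β.trans α, α c + b, fun x => by simp [hσ, hτ, add_assoc]⟩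
  inv_mem' := by
    rintro σ ⟨α, b, hσ⟩
    refine ⟨α.symm, -α.symm b, fun x => ?_⟩
    rw [Equiv.Perm.inv_eq_iff_eq, hσ]
    simp

/-- The number of cycles of length `i` of a permutation, fixed points being the cycles of
length 1. -/
def numCycles {Ω : Type*} [Fintype Ω] [DecidableEq Ω] (σ : Equiv.Perm Ω) (i : ℕ) : ℕ :=
  σ.partition.parts.count i

/-- The cycle type of a permutation of a set of size `n`, as the monomial
`x₁ ^ k₁ * x₂ ^ k₂ * ⋯ * xₙ ^ kₙ` where `kᵢ` is the number of cycles of length `i`.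
The variables are indexed by `ℕ`; the variable with index 0 never occurs. -/
noncomputable def cycleTypeMonomial {Ω : Type*} [Fintype Ω] [DecidableEq Ω]
    (σ : Equiv.Perm Ω) : MvPolynomial ℕ ℚ :=
  ∏ i ∈ Finset.Icc 1 (Fintype.card Ω), X i ^ numCycles σ i

open Classical in
/-- The cycle index of a permutation group on a finite set: the average of the cycle types of
its elements. -/
noncomputable def cycleIndex {Ω : Type*} [Fintype Ω] [DecidableEq Ω]
    (G : Subgroup (Equiv.Perm Ω)) : MvPolynomial ℕ ℚ :=
  C (1 / (Nat.card G : ℚ)) * ∑ σ : Equiv.Perm Ω with σ ∈ G, cycleTypeMonomial σ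

/-! The holomorph of `ZMod n` consists of the maps `x ↦ a * x + b` with `a` a unit. The `d`-th power
of such a map moves `x` by `(1 + a + ⋯ + a ^ (d - 1)) * ((a - 1) * x + b)`, so cycle lengths are
read off from geometric sums.

If `a ≡ 1` modulo `p` (modulo 4 for `p = 2`), lifting the exponent makes the geometric sum as
divisible by `p` as `d` is, and the cycle through `x` has length the additive order of `(a - 1) * x
+ b`. Either `b` is a multiple of `a - 1`, and the map is a translate of multiplication by `a`, or
every cycle has length the order of `b` (`GeomSumRegular.sum_cycleTypeMonomial`).

For odd `p` and any other `a`, `a - 1` is a unit, so there is always a fixed point; lengths follow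
by passing to `a ^ l`, with `l` the prime-to-`p` part of the order of `a`. For `p = 2` and `a ≡ 3`
modulo 4, one passes to `a ^ 2`: even `b` give a fixed point, odd `b` give cycles of one common
length. Counting units by order (odd `p`) or by distance to `±1` (`p = 2`) gives the coefficients.
-/

/-! ### Cycle types from return times of points -/

theorem mul_numCycles_eq_card {Ω : Type*} [Fintype Ω] [DecidableEq Ω] (σ : Equiv.Perm Ω)
    (L : Ω → ℕ) (h : ∀ x d, (σ ^ d) x = x ↔ L x ∣ d) (i : ℕ) :
    numCycles σ i * i = (Finset.univ.filter fun x => L x = i).card := by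
  classical
  have hfix : ∀ x, σ x = x ↔ L x = 1 := fun x => by
    simpa using h x 1
  rw [numCycles, Equiv.Perm.parts_partition, Multiset.count_add]
  -- `cycleType` lists only cycles of length at least 2; fixed points enter `partition` as a block
  -- of ones. So only one of the two counts can be nonzero.
  by_cases hi : i = 1
  · subst hi
    have h0 : σ.cycleType.count 1 = 0 := Multiset.count_eq_zero.2 fun hm =>
      absurd (Equiv.Perm.one_lt_of_mem_cycleType hm) (lt_irrefl _)
    rw [h0, Multiset.count_replicate_self, ← Finset.card_compl]
    simp only [zero_add, mul_one]
    congr 1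
    ext x
    simp [hfix]
  · have h0 : (Multiset.replicate (Fintype.card Ω - σ.support.card) 1).count i = 0 :=
      Multiset.count_eq_zero.2 fun hm => hi (Multiset.eq_of_mem_replicate hm)
    have hL : ∀ x ∈ σ.support, L x = (σ.cycleOf x).support.card := fun x hx => by
      have hx' := Equiv.Perm.mem_support.1 hx
      have hc := Equiv.Perm.isCycle_cycleOf σ hx'
      refine Nat.dvd_right_iff_eq.1 fun d => ?_
      rw [← h, ← hc.orderOf, orderOf_dvd_iff_pow_eq_one, hc.pow_eq_one_iff' (x := x) (by simpa),
        Equiv.Perm.cycleOf_pow_apply_self]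
    rw [h0, add_zero, Equiv.Perm.CycleType.count_def, Fintype.card_subtype,
      Finset.card_eq_sum_card_fiberwise (f := σ.cycleOf)
        (t := Finset.univ.filter fun c => c ∈ σ.cycleFactorsFinset ∧ c.support.card = i)]
    · rw [Finset.sum_const_nat (m := i)]
      · congr 1
        refine Finset.card_bij (fun c _ => c.1) ?_ ?_ ?_
        · rintro ⟨c, hc⟩ h
          simpa [hc] using h
        · rintro ⟨c, hc⟩ - ⟨c', hc'⟩ - h
          simpa using h
        · intro c hc
          simp only [Finset.mem_filter, Finset.mem_univ, true_and] at hc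
          exact ⟨⟨c, hc.1⟩, by simpa using hc.2, rfl⟩
      · intro c hc
        simp only [Finset.mem_filter, Finset.mem_univ, true_and] at hc
        rw [← hc.2]
        congr 1
        ext x
        simp only [Finset.mem_filter, Finset.mem_univ, true_and]
        constructor
        · rintro ⟨hx, rfl⟩
          rw [Equiv.Perm.mem_support_cycleOf_iff]
          exact ⟨Equiv.Perm.SameCycle.refl _ _,
            Equiv.Perm.cycleOf_mem_cycleFactorsFinset_iff.1 hc.1⟩
        · intro hx
          have hxs := Equiv.Perm.mem_cycleFactorsFinset_support_le hc.1 hx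
          have := Equiv.Perm.cycle_is_cycleOf hx hc.1
          exact ⟨by rw [hL x hxs, ← this], this.symm⟩
    · intro x hx
      simp only [Finset.coe_filter, Finset.mem_univ, true_and, Set.mem_ofPred_eq] at hx ⊢
      have hxs : x ∈ σ.support := by
        rw [Equiv.Perm.mem_support, Ne, hfix, hx]; exact hi
      exact ⟨Equiv.Perm.cycleOf_mem_cycleFactorsFinset_iff.2 hxs, by rw [← hL x hxs, hx]⟩

/-- Distinct classes may share a cycle length, so exponents are collected over the fibres of `L`.
Positivity of `N t` bounds `L t` by the size of `Ω`, keeping it in the range of the defining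
product. -/
theorem cycleTypeMonomial_eq_prod {Ω ι : Type*} [Fintype Ω] [DecidableEq Ω] [DecidableEq ι]
    (σ : Equiv.Perm Ω) (s : Finset ι) (f : Ω → ι) (hf : ∀ x, f x ∈ s) (L N : ι → ℕ)
    (h : ∀ x d, (σ ^ d) x = x ↔ L (f x) ∣ d)
    (hL : ∀ t ∈ s, 0 < L t) (hN : ∀ t ∈ s, 0 < N t)
    (hc : ∀ t ∈ s, (Finset.univ.filter fun x => f x = t).card = N t * L t) :
    cycleTypeMonomial σ = ∏ t ∈ s, X (L t) ^ N t := by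
  have key : ∀ i, (Finset.univ.filter fun x => L (f x) = i).card =
      ∑ t ∈ s with L t = i, N t * L t := fun i => by
    rw [Finset.card_eq_sum_card_fiberwise (f := f) (t := s.filter fun t => L t = i)]
    · refine Finset.sum_congr rfl fun t ht => ?_
      rw [Finset.mem_filter] at ht
      rw [← hc t ht.1, Finset.filter_filter]
      congr 1
      ext x
      simp only [Finset.mem_filter, Finset.mem_univ, true_and, and_iff_right_iff_imp]
      rintro rfl
      exact ht.2
    · intro x hx
      simpa [hf] using hx
  rw [cycleTypeMonomial, ← Finset.prod_fiberwise_of_maps_to (s := s) (g := L)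
    (t := Finset.Icc 1 (Fintype.card Ω))]
  · refine Finset.prod_congr rfl fun i hi => ?_
    have : numCycles σ i = ∑ t ∈ s with L t = i, N t := by
      refine Nat.eq_of_mul_eq_mul_right (Finset.mem_Icc.1 hi).1 ?_
      rw [mul_numCycles_eq_card σ _ h, key, Finset.sum_mul]
      refine Finset.sum_congr rfl fun t ht => ?_
      rw [(Finset.mem_filter.1 ht).2]
    rw [this, ← Finset.prod_pow_eq_pow_sum]
    refine Finset.prod_congr rfl fun t ht => ?_
    rw [(Finset.mem_filter.1 ht).2]
  · intro t ht
    rw [Finset.mem_Icc]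
    refine ⟨hL t ht, ?_⟩
    calc L t ≤ N t * L t := Nat.le_mul_of_pos_left _ (hN t ht)
      _ = _ := (hc t ht).symm
      _ ≤ _ := Finset.card_le_univ _

theorem cycleTypeMonomial_eq_pow {Ω : Type*} [Fintype Ω] [DecidableEq Ω]
    (σ : Equiv.Perm Ω) (L N : ℕ) (h : ∀ x d, (σ ^ d) x = x ↔ L ∣ d)
    (hL : 0 < L) (hN : 0 < N) (hc : Fintype.card Ω = N * L) :
    cycleTypeMonomial σ = X L ^ N := by
  have := cycleTypeMonomial_eq_prod σ {()} (fun _ => ()) (by simp) (fun _ => L) (fun _ => N) h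
    (by simpa) (by simpa) (by simpa using hc)
  simpa using this

/-! ### The holomorph as the group of affine maps -/

/-- The permutation `x ↦ a * x + b` of `ZMod n`. -/
def affinePerm {n : ℕ} (a : (ZMod n)ˣ) (b : ZMod n) : Equiv.Perm (ZMod n) :=
  (Units.mulLeft a).trans (Equiv.addRight b)

@[simp]
theorem affinePerm_apply {n : ℕ} (a : (ZMod n)ˣ) (b x : ZMod n) :
    affinePerm a b x = a * x + b := rfl

theorem affinePerm_pow_apply {n : ℕ} (a : (ZMod n)ˣ) (b x : ZMod n) (d : ℕ) :
    (affinePerm a b ^ d) x =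
      x + (∑ i ∈ Finset.range d, (a : ZMod n) ^ i) * ((a - 1) * x + b) := by
  induction d with
  | zero => simp
  | succ d ih =>
    rw [pow_succ', Equiv.Perm.mul_apply, ih, affinePerm_apply, geom_sum_succ]
    ring

theorem affinePerm_pow_apply_eq_iff {n : ℕ} (a : (ZMod n)ˣ) (b x : ZMod n) (d : ℕ) :
    (affinePerm a b ^ d) x = x ↔
      (∑ i ∈ Finset.range d, (a : ZMod n) ^ i) * ((a - 1) * x + b) = 0 := by
  rw [affinePerm_pow_apply, add_eq_left]

theorem mem_holomorph_zmod_iff {n : ℕ} (σ : Equiv.Perm (ZMod n)) :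
    σ ∈ holomorph (ZMod n) ↔ ∃ a b, affinePerm a b = σ := by
  constructor
  · rintro ⟨α, b, h⟩
    -- As 1 generates `ZMod n` additively, an additive map is multiplication by its value at 1.
    have key : ∀ (β : ZMod n ≃+ ZMod n) x, β x = β 1 * x := fun β x => by
      obtain ⟨m, rfl⟩ := ZMod.intCast_surjective x
      rw [← zsmul_one, map_zsmul, zsmul_eq_mul, zsmul_eq_mul, mul_one, mul_comm]
    refine ⟨⟨α 1, α.symm 1, ?_, ?_⟩, b, ?_⟩
    · rw [← key, AddEquiv.apply_symm_apply]
    · rw [← key, AddEquiv.symm_apply_apply]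
    · ext x
      rw [h, key α x]
      rfl
  · rintro ⟨a, b, rfl⟩
    exact ⟨{ Units.mulLeft a with map_add' := mul_add (a : ZMod n) }, b, fun x => rfl⟩

theorem affinePerm_injective {n : ℕ} :
    Function.Injective fun q : (ZMod n)ˣ × ZMod n => affinePerm q.1 q.2 := by
  rintro ⟨a, b⟩ ⟨a', b'⟩ h
  have h0 := DFunLike.congr_fun h 0
  have h1 := DFunLike.congr_fun h 1
  simp only [affinePerm_apply, mul_zero, zero_add, mul_one] at h0 h1
  subst h0
  simpa [Units.ext_iff] using h1

theorem cycleIndex_holomorph_zmod {n : ℕ} [NeZero n] :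
    cycleIndex (holomorph (ZMod n)) = C (1 / ((n.totient * n : ℕ) : ℚ)) *
      ∑ a : (ZMod n)ˣ, ∑ b : ZMod n, cycleTypeMonomial (affinePerm a b) := by
  classical
  have himg : (Finset.univ.filter fun σ : Equiv.Perm (ZMod n) => σ ∈ holomorph (ZMod n)) =
      Finset.univ.image fun q : (ZMod n)ˣ × ZMod n => affinePerm q.1 q.2 := by
    ext σ
    simp [mem_holomorph_zmod_iff]
  have hcard : Nat.card (holomorph (ZMod n)) = n.totient * n := by
    rw [Nat.card_eq_fintype_card, Fintype.card_subtype, himg,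
      Finset.card_image_of_injective _ affinePerm_injective, Finset.card_univ, Fintype.card_prod,
      ZMod.card_units_eq_totient, ZMod.card]
  rw [cycleIndex, hcard]
  congr 1
  rw [← Fintype.sum_prod_type', ← Finset.sum_image (g := fun q : (ZMod n)ˣ × ZMod n =>
    affinePerm q.1 q.2) (f := cycleTypeMonomial) affinePerm_injective.injOn, ← himg]

/-! ### Geometric sums and lifting the exponent -/

/-- The geometric sums `1 + a + ⋯ + a ^ (d - 1)` are associated to `d` in `ZMod n`. -/
def GeomSumRegular {n : ℕ} (a : ZMod n) : Prop :=
  ∀ (d : ℕ) (y : ZMod n), (∑ i ∈ Finset.range d, a ^ i) * y = 0 ↔ addOrderOf y ∣ d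

/-- Cancelling the multiplicity of `z - 1` in `z ^ d - 1 = (z - 1) * (1 + ⋯ + z ^ (d - 1))` leaves
that of `d` for the sum. The cancellation needs a finite multiplicity, hence the separate case `z =
1`. -/
theorem geomSumRegular_intCast {p k : ℕ} (hp : p.Prime) {z : ℤ}
    (h : ∀ d : ℕ, emultiplicity (p : ℤ) (z ^ d - 1) =
      emultiplicity (p : ℤ) (z - 1) + emultiplicity (p : ℤ) d) :
    GeomSumRegular (z : ZMod (p ^ k)) := by
  intro d y
  obtain ⟨m, rfl⟩ := ZMod.intCast_surjective y
  have hp' := Nat.prime_iff_prime_int.1 hp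
  rw [addOrderOf_dvd_iff_nsmul_eq_zero, nsmul_eq_mul]
  rcases eq_or_ne z 1 with rfl | hz
  · simp
  have hfin : emultiplicity (p : ℤ) (z - 1) ≠ ⊤ := by
    rw [← finiteMultiplicity_iff_emultiplicity_ne_top, Int.finiteMultiplicity_iff]
    exact ⟨by simpa using hp.ne_one, sub_ne_zero.2 hz⟩
  have hs : emultiplicity (p : ℤ) (∑ i ∈ Finset.range d, z ^ i) = emultiplicity (p : ℤ) d := by
    have := h d
    rw [← mul_geom_sum, emultiplicity_mul hp'] at this
    exact ENat.add_right_injective_of_ne_top hfin this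
  have h1 : (∑ i ∈ Finset.range d, (z : ZMod (p ^ k)) ^ i) * (m : ZMod (p ^ k)) =
      (((∑ i ∈ Finset.range d, z ^ i) * m : ℤ) : ZMod (p ^ k)) := by push_cast; rfl
  have h2 : (d : ZMod (p ^ k)) * (m : ZMod (p ^ k)) = ((d * m : ℤ) : ZMod (p ^ k)) := by
    push_cast; rfl
  rw [h1, h2, ZMod.intCast_zmod_eq_zero_iff_dvd, ZMod.intCast_zmod_eq_zero_iff_dvd, Nat.cast_pow,
    pow_dvd_iff_le_emultiplicity, pow_dvd_iff_le_emultiplicity, emultiplicity_mul hp',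
    emultiplicity_mul hp', hs]

theorem exists_intCast_of_natCast_dvd_sub_one {m n : ℕ} {a : ZMod n}
    (h : (m : ZMod n) ∣ a - 1) : ∃ z : ℤ, (z : ZMod n) = a ∧ (m : ℤ) ∣ z - 1 := by
  obtain ⟨c, hc⟩ := h
  obtain ⟨y, rfl⟩ := ZMod.intCast_surjective c
  exact ⟨1 + m * y, by push_cast; rw [← hc]; ring, by simp⟩

theorem geomSumRegular_of_odd {p k : ℕ} (hp : p.Prime) (hp2 : p ≠ 2)
    {a : ZMod (p ^ k)} (h : (p : ZMod (p ^ k)) ∣ a - 1) : GeomSumRegular a := by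
  obtain ⟨z, rfl, hz⟩ := exists_intCast_of_natCast_dvd_sub_one h
  refine geomSumRegular_intCast hp fun d => ?_
  have := Int.emultiplicity_pow_sub_pow hp (hp.odd_of_ne_two hp2) (x := z) (y := 1) hz ?_ d
  · rwa [one_pow, ← Int.natCast_emultiplicity] at this
  · intro hz'
    exact (Nat.prime_iff_prime_int.1 hp).not_dvd_one (by simpa using dvd_sub hz' hz)

theorem geomSumRegular_two {k : ℕ}
    {a : ZMod (2 ^ k)} (h : (4 : ZMod (2 ^ k)) ∣ a - 1) : GeomSumRegular a := by
  obtain ⟨z, rfl, hz⟩ := exists_intCast_of_natCast_dvd_sub_one (m := 4) (by simpa)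
  refine geomSumRegular_intCast Nat.prime_two fun d => ?_
  have := Int.two_pow_sub_pow' (x := z) (y := 1) d hz (by push_cast at hz; omega)
  rwa [one_pow] at this

theorem GeomSumRegular.pow_mul_eq_iff {n : ℕ} {a : ZMod n} (ha : GeomSumRegular a) (d : ℕ)
    (x : ZMod n) : a ^ d * x = x ↔ addOrderOf ((a - 1) * x) ∣ d := by
  rw [← ha, ← mul_assoc, geom_sum_mul, sub_mul, one_mul, sub_eq_zero]

theorem GeomSumRegular.orderOf_eq {n : ℕ} {a : ZMod n} (ha : GeomSumRegular a) :
    orderOf a = addOrderOf (a - 1) := by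
  refine Nat.dvd_right_iff_eq.1 fun d => ?_
  rw [orderOf_dvd_iff_pow_eq_one]
  simpa using ha.pow_mul_eq_iff d 1

/-! ### Additive orders in `ZMod (p ^ k)` -/

section PrimePow

variable {p k : ℕ} [hp : Fact p.Prime]

theorem addOrderOf_natCast_pow (m : ℕ) :
    addOrderOf ((p : ZMod (p ^ k)) ^ m) = p ^ (k - m) := by
  rw [← Nat.cast_pow, ZMod.addOrderOf_coe _ (pow_ne_zero _ hp.out.ne_zero)]
  rcases le_total k m with h | h
  · rw [Nat.gcd_eq_left (pow_dvd_pow p h), Nat.sub_eq_zero_of_le h, pow_zero,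
      Nat.div_self (pow_pos hp.out.pos _)]
  · rw [Nat.gcd_eq_right (pow_dvd_pow p h), Nat.pow_div h hp.out.pos]

theorem addOrderOf_mul_unit {n : ℕ} (x : ZMod n) (u : (ZMod n)ˣ) :
    addOrderOf (x * u) = addOrderOf x :=
  addOrderOf_injective (AddMonoidHom.mulRight (u : ZMod n)) (fun _ _ h => u.mul_left_inj.1 h) x

theorem exists_addOrderOf_eq_pow (x : ZMod (p ^ k)) : ∃ j ≤ k, addOrderOf x = p ^ j := by
  have h := addOrderOf_dvd_natCard x
  rw [Nat.card_zmod] at h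
  exact (Nat.dvd_prime_pow hp.out).1 h

theorem exists_eq_natCast_pow_mul_unit (x : ZMod (p ^ k)) :
    ∃ j ≤ k, ∃ u : (ZMod (p ^ k))ˣ, x = (p : ZMod (p ^ k)) ^ (k - j) * u := by
  obtain ⟨m, rfl⟩ := ZMod.natCast_zmod_surjective x
  rcases eq_or_ne m 0 with rfl | hm
  · exact ⟨0, k.zero_le, 1, by rw [Nat.sub_zero, ← Nat.cast_pow]; simp⟩
  obtain ⟨e, r, hr, rfl⟩ := Nat.exists_eq_pow_mul_and_not_dvd hm p hp.out.ne_one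
  rcases le_total e k with h | h
  · refine ⟨k - e, Nat.sub_le _ _, ZMod.unitOfCoprime r ?_, ?_⟩
    · exact (Nat.Coprime.pow_left _ ((Nat.Prime.coprime_iff_not_dvd hp.out).2 hr)).symm
    · rw [Nat.sub_sub_self h]
      push_cast
      rfl
  · refine ⟨0, k.zero_le, 1, ?_⟩
    rw [Nat.sub_zero, ← Nat.cast_pow, Nat.cast_mul,
      (ZMod.natCast_eq_zero_iff (p ^ e) (p ^ k)).2 (pow_dvd_pow p h)]
    simp

theorem eq_natCast_pow_mul_unit {x : ZMod (p ^ k)} {j : ℕ} (hx : addOrderOf x = p ^ j) :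
    ∃ u : (ZMod (p ^ k))ˣ, x = (p : ZMod (p ^ k)) ^ (k - j) * u := by
  obtain ⟨i, hi, u, rfl⟩ := exists_eq_natCast_pow_mul_unit x
  rw [addOrderOf_mul_unit, addOrderOf_natCast_pow, Nat.sub_sub_self hi] at hx
  exact ⟨u, by rw [Nat.pow_right_injective hp.out.two_le hx]⟩

theorem le_of_addOrderOf_eq_pow {x : ZMod (p ^ k)} {j : ℕ} (hx : addOrderOf x = p ^ j) :
    j ≤ k := by
  obtain ⟨i, hi, h⟩ := exists_addOrderOf_eq_pow x
  exact (Nat.pow_right_injective hp.out.two_le (hx.symm.trans h)).trans_le hi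

/-- Order `p ^ i` means valuation `k - i`, and valuations add. The truncated subtraction covers a
zero product. -/
theorem addOrderOf_mul_eq {x y : ZMod (p ^ k)} {i j : ℕ} (hx : addOrderOf x = p ^ i)
    (hy : addOrderOf y = p ^ j) : addOrderOf (x * y) = p ^ (i + j - k) := by
  have hi := le_of_addOrderOf_eq_pow hx
  have hj := le_of_addOrderOf_eq_pow hy
  obtain ⟨u, rfl⟩ := eq_natCast_pow_mul_unit hx
  obtain ⟨v, rfl⟩ := eq_natCast_pow_mul_unit hy
  rw [mul_mul_mul_comm, ← pow_add, ← Units.val_mul, addOrderOf_mul_unit, addOrderOf_natCast_pow]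
  congr 1
  omega

theorem dvd_of_addOrderOf_dvd {x y : ZMod (p ^ k)} (h : addOrderOf y ∣ addOrderOf x) :
    x ∣ y := by
  obtain ⟨i, hi, hx⟩ := exists_addOrderOf_eq_pow x
  obtain ⟨j, hj, hy⟩ := exists_addOrderOf_eq_pow y
  rw [hx, hy, Nat.pow_dvd_pow_iff_le_right hp.out.one_lt] at h
  obtain ⟨u, rfl⟩ := eq_natCast_pow_mul_unit hx
  obtain ⟨v, rfl⟩ := eq_natCast_pow_mul_unit hy
  rw [u.mul_right_dvd]
  exact (pow_dvd_pow _ (by omega)).trans (dvd_mul_right _ _)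

/-- Ultrametric principle: `c * x` is killed by a smaller power of `p` than `b` is. -/
theorem addOrderOf_mul_add {b c : ZMod (p ^ k)} (h : ¬ addOrderOf b ∣ addOrderOf c)
    (x : ZMod (p ^ k)) : addOrderOf (c * x + b) = addOrderOf b := by
  obtain ⟨i, hi, hc⟩ := exists_addOrderOf_eq_pow c
  obtain ⟨j, hj, hb⟩ := exists_addOrderOf_eq_pow b
  rw [hc, hb, Nat.pow_dvd_pow_iff_le_right hp.out.one_lt, not_le] at h
  have hc0 : ∀ m, i ≤ m → p ^ m • (c * x) = 0 := fun m hm => by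
    rw [← smul_mul_assoc, addOrderOf_dvd_iff_nsmul_eq_zero.1, zero_mul]
    rw [hc]
    exact pow_dvd_pow p hm
  obtain ⟨j, rfl⟩ := Nat.exists_eq_succ_of_ne_zero h.ne_bot
  rw [hb]
  refine addOrderOf_eq_prime_pow ?_ ?_
  · rw [smul_add, hc0 _ (Nat.lt_succ_iff.1 h), zero_add, ← addOrderOf_dvd_iff_nsmul_eq_zero, hb,
      Nat.pow_dvd_pow_iff_le_right hp.out.one_lt]
    omega
  · rw [smul_add, hc0 _ h.le, zero_add, ← addOrderOf_dvd_iff_nsmul_eq_zero, hb]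

theorem isUnit_or_natCast_dvd (x : ZMod (p ^ k)) : IsUnit x ∨ (p : ZMod (p ^ k)) ∣ x := by
  obtain ⟨j, hj, u, rfl⟩ := exists_eq_natCast_pow_mul_unit x
  rcases hj.eq_or_lt with rfl | hj
  · simp
  · exact Or.inr ((dvd_pow_self _ (by omega)).trans (dvd_mul_right _ _))

theorem isUnit_of_addOrderOf_eq {x : ZMod (p ^ k)} (hx : addOrderOf x = p ^ k) : IsUnit x := by
  obtain ⟨u, rfl⟩ := eq_natCast_pow_mul_unit hx
  simp

theorem natCast_pow_dvd_iff {m : ℕ} {x : ZMod (p ^ k)} :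
    (p : ZMod (p ^ k)) ^ m ∣ x ↔ addOrderOf x ∣ p ^ (k - m) := by
  constructor
  · rintro ⟨y, rfl⟩
    rw [← addOrderOf_natCast_pow, addOrderOf_dvd_iff_nsmul_eq_zero, ← smul_mul_assoc,
      addOrderOf_nsmul_eq_zero, zero_mul]
  · intro h
    exact dvd_of_addOrderOf_dvd (by rwa [addOrderOf_natCast_pow])

/-- Modulo `p`, Frobenius gives `(a - 1) ^ p ^ w = a ^ p ^ w - 1 = 0`. -/
theorem natCast_dvd_sub_one_of_pow_eq_one (hk : k ≠ 0) {a : ZMod (p ^ k)} {w : ℕ}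
    (h : a ^ p ^ w = 1) : (p : ZMod (p ^ k)) ∣ a - 1 := by
  refine (isUnit_or_natCast_dvd _).resolve_left fun hu => ?_
  let f := ZMod.castHom (dvd_pow_self p hk) (ZMod p)
  have h1 : (f (a - 1)) ^ p ^ w = 0 := by
    rw [map_sub, map_one, sub_pow_char_pow, ← map_pow, h, map_one, one_pow, sub_self]
  exact (hu.map f).ne_zero ((pow_eq_zero_iff (pow_pos hp.out.pos _).ne').1 h1)

theorem card_filter_addOrderOf {j : ℕ} (hj : j ≤ k) :
    (Finset.univ.filter fun x : ZMod (p ^ k) => addOrderOf x = p ^ j).card =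
      Nat.totient (p ^ j) :=
  IsAddCyclic.card_addOrderOf_eq_totient (by rw [ZMod.card]; exact pow_dvd_pow p hj)

theorem sum_addOrderOf {M : Type*} [AddCommMonoid M] (f : ℕ → M) :
    ∑ x : ZMod (p ^ k), f (addOrderOf x) =
      ∑ j ∈ Finset.range (k + 1), Nat.totient (p ^ j) • f (p ^ j) := by
  rw [← Nat.sum_divisors_prime_pow (f := fun d => Nat.totient d • f d) hp.out,
    ← Finset.sum_fiberwise_of_maps_to (g := fun x : ZMod (p ^ k) => addOrderOf x)
      (t := (p ^ k).divisors)]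
  · refine Finset.sum_congr rfl fun d hd => ?_
    obtain ⟨j, hj, rfl⟩ := (Nat.mem_divisors_prime_pow hp.out k).1 hd
    rw [← card_filter_addOrderOf hj, Finset.sum_congr rfl (g := fun _ => f (p ^ j)),
      Finset.sum_const]
    intro x hx
    rw [(Finset.mem_filter.1 hx).2]
  · intro x _
    obtain ⟨j, hj, h⟩ := exists_addOrderOf_eq_pow x
    exact (Nat.mem_divisors_prime_pow hp.out k).2 ⟨j, hj, h⟩

/-- The cycle type of an affine map with a fixed point: the points at distance of order `p ^ j`
from the fixed point lie on cycles of a common length. -/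
theorem cycleTypeMonomial_affinePerm_mul (a : (ZMod (p ^ k))ˣ) (t : ZMod (p ^ k)) (L N : ℕ → ℕ)
    (h : ∀ x j d, addOrderOf x = p ^ j → ((a : ZMod (p ^ k)) ^ d * x = x ↔ L j ∣ d))
    (hN : ∀ j ≤ k, N j * L j = Nat.totient (p ^ j)) :
    cycleTypeMonomial (affinePerm a ((a - 1) * t)) =
      ∏ j ∈ Finset.range (k + 1), X (L j) ^ N j := by
  have hj : ∀ x : ZMod (p ^ k), addOrderOf x = p ^ padicValNat p (addOrderOf x) := fun x => by
    obtain ⟨j, _, hx⟩ := exists_addOrderOf_eq_pow x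
    rw [hx, padicValNat.prime_pow]
  have hpos : ∀ j ∈ Finset.range (k + 1), 0 < N j * L j := fun j hj => by
    rw [hN j (Finset.mem_range_succ_iff.1 hj)]
    exact Nat.totient_pos.2 (pow_pos hp.out.pos _)
  -- The fixed point is `-t`, and translation by `t` turns the map into multiplication by `a`.
  refine cycleTypeMonomial_eq_prod _ _ (fun x => padicValNat p (addOrderOf (x + t))) ?_ L N ?_
    (fun j hj => Nat.pos_of_mul_pos_left (hpos j hj))
    (fun j hj => Nat.pos_of_mul_pos_right (hpos j hj)) ?_
  · exact fun x => Finset.mem_range_succ_iff.2 (le_of_addOrderOf_eq_pow (hj _))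
  · intro x d
    rw [affinePerm_pow_apply_eq_iff, ← h _ _ d (hj (x + t)), ← mul_add, ← mul_assoc, geom_sum_mul,
      sub_mul, one_mul, sub_eq_zero]
  · intro j hj'
    have hjk := Finset.mem_range_succ_iff.1 hj'
    rw [hN j hjk, ← card_filter_addOrderOf hjk]
    refine Finset.card_equiv (Equiv.addRight t) fun x => ?_
    simp only [Finset.mem_filter, Finset.mem_univ, true_and, Equiv.coe_addRight]
    constructor
    · rintro rfl
      exact hj _
    · intro hx
      rw [hx, padicValNat.prime_pow]

theorem GeomSumRegular.cycleTypeMonomial_affinePerm {a : (ZMod (p ^ k))ˣ}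
    (ha : GeomSumRegular (a : ZMod (p ^ k))) {b : ZMod (p ^ k)}
    (hb : ¬ addOrderOf b ∣ addOrderOf ((a : ZMod (p ^ k)) - 1)) {j : ℕ}
    (hj : addOrderOf b = p ^ j) :
    cycleTypeMonomial (affinePerm a b) = X (p ^ j) ^ p ^ (k - j) := by
  refine cycleTypeMonomial_eq_pow _ _ _ (fun x d => ?_) (pow_pos hp.out.pos _)
    (pow_pos hp.out.pos _) ?_
  · rw [affinePerm_pow_apply_eq_iff, ha, addOrderOf_mul_add hb, hj]
  · rw [ZMod.card, ← pow_add, Nat.sub_add_cancel (le_of_addOrderOf_eq_pow hj)]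

end PrimePow

/-! ### Reindexing and the monomial of a multiplication map -/

theorem prod_Icc_one_eq_prod_range {M : Type*} [CommMonoid M] (f : ℕ → M) (w : ℕ) :
    ∏ u ∈ Finset.Icc 1 w, f u = ∏ i ∈ Finset.range w, f (i + 1) := by
  rw [Finset.range_eq_Ico, Finset.prod_Ico_add' f 0 w 1, zero_add]
  rfl

theorem prod_Icc_two_eq_prod_range {M : Type*} [CommMonoid M] (f : ℕ → M) (w : ℕ) :
    ∏ u ∈ Finset.Icc 2 (w + 1), f u = ∏ i ∈ Finset.range w, f (i + 2) := by
  rw [Finset.range_eq_Ico, Finset.prod_Ico_add' f 0 w 2, zero_add]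
  rfl

theorem sum_Icc_one_eq_sum_range {M : Type*} [AddCommMonoid M] (f : ℕ → M) (w : ℕ) :
    ∑ u ∈ Finset.Icc 1 w, f u = ∑ i ∈ Finset.range w, f (i + 1) := by
  rw [Finset.range_eq_Ico, Finset.sum_Ico_add' f 0 w 1, zero_add]
  rfl

theorem sum_Icc_two_eq_sum_range {M : Type*} [AddCommMonoid M] (f : ℕ → M) (w : ℕ) :
    ∑ u ∈ Finset.Icc 2 (w + 1), f u = ∑ i ∈ Finset.range w, f (i + 2) := by
  rw [Finset.range_eq_Ico, Finset.sum_Ico_add' f 0 w 2, zero_add]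
  rfl

/-- The monomial `x₁ * x_l ^ ((p ^ (k - w) - 1) / l) * ∏ x_{l p ^ u} ^ (p ^ (k - 1 - w) (p - 1) / l)`
with `u` ranging over `1, …, w`: the cycle type of the multiplication by an element of order
`l p ^ w` of `ZMod (p ^ k)`. -/
noncomputable def mulMonomial (p k w l : ℕ) : MvPolynomial ℕ ℚ :=
  X 1 * X l ^ ((p ^ (k - w) - 1) / l) *
    ∏ u ∈ Finset.Icc 1 w, X (l * p ^ u) ^ (p ^ (k - 1 - w) * (p - 1) / l)

theorem mulMonomial_one {p : ℕ} (hp : 0 < p) (k w : ℕ) : mulMonomial p k w 1 =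
    X 1 ^ p ^ (k - w) * ∏ u ∈ Finset.Icc 1 w, X (p ^ u) ^ (p ^ (k - w - 1) * (p - 1)) := by
  rw [mulMonomial, Nat.div_one, ← pow_succ', Nat.sub_add_cancel (Nat.one_le_pow _ _ hp),
    Nat.sub_right_comm]
  simp only [Nat.div_one, one_mul]

/-- Here `j` indexes the elements of order `p ^ j`. The zero element gives `x₁`; the classes `1 ≤ j
≤ k - w` all have length `l`, their exponents forming a geometric sum; `j = k - w + u` gives length
`l * p ^ u`. -/
theorem prod_range_eq_mulMonomial {p k w l q : ℕ} (hp : 0 < p) (hl : 0 < l) (hlq : l * q = p - 1)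
    (hw : w < k) :
    ∏ j ∈ Finset.range (k + 1), (X (if j = 0 then 1 else l * p ^ (w + j - k)) : MvPolynomial ℕ ℚ) ^
      (if j = 0 then 1 else p ^ (min j (k - w) - 1) * q) = mulMonomial p k w l := by
  obtain ⟨m, rfl⟩ : ∃ m, k = m + 1 + w := ⟨k - w - 1, by omega⟩
  rw [mulMonomial, Finset.prod_range_succ', Finset.prod_range_add, prod_Icc_one_eq_prod_range,
    mul_comm, ← mul_assoc]
  have hm : m + 1 + w - w = m + 1 := by omega
  have hm' : m + 1 + w - 1 - w = m := by omega
  simp only [hm, hm', if_true, pow_one, Nat.add_eq_zero_iff, one_ne_zero, and_false, if_false]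
  congr 1
  · congr 1
    have h1 : ∀ i ∈ Finset.range (m + 1), (X (l * p ^ (w + (i + 1) - (m + 1 + w))) :
        MvPolynomial ℕ ℚ) ^ (p ^ (min (i + 1) (m + 1) - 1) * q) = X l ^ (p ^ i * q) := by
      intro i hi
      rw [Finset.mem_range] at hi
      have h1 : w + (i + 1) - (m + 1 + w) = 0 := by omega
      have h2 : min (i + 1) (m + 1) - 1 = i := by omega
      rw [h1, h2, pow_zero, mul_one]
    rw [Finset.prod_congr rfl h1, Finset.prod_pow_eq_pow_sum, ← Finset.sum_mul]
    congr 1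
    refine (Nat.div_eq_of_eq_mul_left hl ?_).symm
    rw [mul_assoc, mul_comm q, hlq]
    have := geom_sum_mul_add (p - 1) (m + 1)
    rw [Nat.sub_add_cancel (Nat.one_le_of_lt hp)] at this
    omega
  · refine Finset.prod_congr rfl fun i _ => ?_
    have h1 : w + (m + 1 + i + 1) - (m + 1 + w) = i + 1 := by omega
    have h2 : min (m + 1 + i + 1) (m + 1) - 1 = m := by omega
    rw [h1, h2, ← hlq, mul_left_comm, Nat.mul_div_cancel_left _ hl]

/-! ### Sums over translations, and the odd prime case -/

section PrimePow

variable {p k : ℕ} [hp : Fact p.Prime]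

theorem cycleTypeMonomial_affinePerm_eq_mulMonomial {l q w : ℕ} (hl : 0 < l) (hlq : l * q = p - 1)
    (hw : w < k) (a : (ZMod (p ^ k))ˣ) (t : ZMod (p ^ k))
    (h : ∀ x j d, j ≠ 0 → addOrderOf x = p ^ j →
      ((a : ZMod (p ^ k)) ^ d * x = x ↔ l * p ^ (w + j - k) ∣ d)) :
    cycleTypeMonomial (affinePerm a ((a - 1) * t)) = mulMonomial p k w l := by
  rw [← prod_range_eq_mulMonomial hp.out.pos hl hlq hw]
  refine cycleTypeMonomial_affinePerm_mul a t _ _ (fun x j d hx => ?_) fun j hj => ?_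
  · rcases eq_or_ne j 0 with rfl | hj
    · rw [pow_zero, AddMonoid.addOrderOf_eq_one_iff] at hx
      simp [hx]
    · rw [if_neg hj, h x j d hj hx]
  · rcases eq_or_ne j 0 with rfl | hj0
    · simp
    · rw [if_neg hj0, if_neg hj0, Nat.totient_prime_pow hp.out (Nat.pos_of_ne_zero hj0), ← hlq]
      have : j - 1 = (min j (k - w) - 1) + (w + j - k) := by omega
      rw [this, pow_add]
      ring

/-- The `p ^ w` elements `b` of order dividing that of `a - 1` are its multiples, so their maps have
fixed points; the others are grouped by order. -/
theorem GeomSumRegular.sum_cycleTypeMonomial {a : (ZMod (p ^ k))ˣ}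
    (ha : GeomSumRegular (a : ZMod (p ^ k))) {w : ℕ} (hw : w < k)
    (h : addOrderOf ((a : ZMod (p ^ k)) - 1) = p ^ w) :
    ∑ b, cycleTypeMonomial (affinePerm a b) = C ((p : ℚ) ^ w) * mulMonomial p k w 1 +
      ∑ j ∈ Finset.Icc (w + 1) k, C (Nat.totient (p ^ j) : ℚ) * X (p ^ j) ^ p ^ (k - j) := by
  have key : ∀ b, cycleTypeMonomial (affinePerm a b) =
      if addOrderOf b ∣ p ^ w then mulMonomial p k w 1 else
        X (addOrderOf b) ^ (p ^ k / addOrderOf b) := fun b => by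
    split_ifs with hb
    · obtain ⟨t, rfl⟩ := dvd_of_addOrderOf_dvd (hb.trans h.symm.dvd)
      refine cycleTypeMonomial_affinePerm_eq_mulMonomial one_pos (one_mul _) hw a t
        fun x j d _ hx => ?_
      rw [ha.pow_mul_eq_iff, addOrderOf_mul_eq h hx, one_mul]
    · obtain ⟨j, hj, hbj⟩ := exists_addOrderOf_eq_pow b
      rw [ha.cycleTypeMonomial_affinePerm (by rwa [h]) hbj, hbj, Nat.pow_div hj hp.out.pos]
  rw [Finset.sum_congr rfl fun b _ => key b, sum_addOrderOf fun d => if d ∣ p ^ w then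
    mulMonomial p k w 1 else X d ^ (p ^ k / d), Finset.range_eq_Ico,
    ← Finset.sum_Ico_consecutive _ (Nat.zero_le (w + 1)) (by omega : w + 1 ≤ k + 1)]
  congr 1
  · rw [← Finset.range_eq_Ico, Finset.sum_congr rfl (g := fun j => Nat.totient (p ^ j) •
      mulMonomial p k w 1), ← Finset.sum_smul,
      ← Nat.sum_divisors_prime_pow (f := Nat.totient) hp.out, Nat.sum_totient, nsmul_eq_mul]
    · simp
    · intro j hj
      rw [if_pos (pow_dvd_pow p (Finset.mem_range_succ_iff.1 hj))]
  · refine Finset.sum_congr rfl fun j hj => ?_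
    rw [Finset.mem_Icc] at hj
    rw [if_neg, Nat.pow_div (by omega) hp.out.pos, nsmul_eq_mul]
    · simp
    · rw [Nat.pow_dvd_pow_iff_le_right hp.out.one_lt]
      omega

/-- If `a ^ d` fixes a nonzero `x`, then `a ^ d - 1` is not a unit, so `a ^ d ≡ 1` modulo `p` and
its order is a power of `p`; this forces `l ∣ d`. What remains concerns `a ^ l`, which is 1 modulo
`p`. -/
theorem pow_mul_eq_iff_of_orderOf_eq (hp2 : p ≠ 2) {l w : ℕ} (hl : l.Coprime p)
    {a : ZMod (p ^ k)} (ha : orderOf a = l * p ^ w) {x : ZMod (p ^ k)} {j : ℕ} (hj : j ≠ 0)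
    (hx : addOrderOf x = p ^ j) (d : ℕ) : a ^ d * x = x ↔ l * p ^ (w + j - k) ∣ d := by
  have hk : k ≠ 0 := by have := le_of_addOrderOf_eq_pow hx; omega
  have h1 : a ^ d * x = x → l ∣ d := by
    intro h
    have h2 : (p : ZMod (p ^ k)) ∣ a ^ d - 1 := by
      refine (isUnit_or_natCast_dvd _).resolve_left fun hu => ?_
      have : (a ^ d - 1) * x = 0 := by rw [sub_mul, h, one_mul, sub_self]
      rw [hu.mul_right_eq_zero.1 this, addOrderOf_zero] at hx
      exact hp.out.ne_one (Nat.pow_eq_one.1 hx.symm |>.resolve_right hj)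
    have h3 : orderOf (a ^ d) ∣ p ^ (k - 1) := by
      rw [(geomSumRegular_of_odd hp.out hp2 h2).orderOf_eq, ← natCast_pow_dvd_iff, pow_one]
      exact h2
    rw [orderOf_dvd_iff_pow_eq_one, ← pow_mul, ← orderOf_dvd_iff_pow_eq_one, ha] at h3
    exact (hl.pow_right _).dvd_of_dvd_mul_right ((dvd_mul_right _ _).trans h3)
  have hl0 : l ≠ 0 := by
    rintro rfl
    exact hp.out.ne_one (by simpa using hl)
  have hal : orderOf (a ^ l) = p ^ w := by
    rw [orderOf_pow' a hl0, ha, Nat.gcd_mul_right_left, Nat.mul_div_cancel_left _ (by omega)]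
  have hgood := geomSumRegular_of_odd hp.out hp2
    (natCast_dvd_sub_one_of_pow_eq_one hk (by rw [← hal, pow_orderOf_eq_one]))
  have hord := hgood.orderOf_eq
  rw [hal] at hord
  constructor
  · intro h
    obtain ⟨e, rfl⟩ := h1 h
    rw [pow_mul, hgood.pow_mul_eq_iff, addOrderOf_mul_eq hord.symm hx] at h
    exact Nat.mul_dvd_mul_left l h
  · rintro ⟨e, rfl⟩
    rw [mul_assoc, pow_mul, hgood.pow_mul_eq_iff, addOrderOf_mul_eq hord.symm hx]
    exact dvd_mul_right _ _

/-- As `l > 1`, the order of `a` is not a power of `p`, so `a - 1` is a unit and each of the `p ^ k`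
translations leaves a fixed point. -/
theorem sum_cycleTypeMonomial_of_orderOf_eq (hp2 : p ≠ 2) {l w : ℕ} (hl : l ∣ p - 1) (hl1 : 1 < l)
    (hw : w < k) {a : (ZMod (p ^ k))ˣ} (ha : orderOf a = l * p ^ w) :
    ∑ b, cycleTypeMonomial (affinePerm a b) = C ((p : ℚ) ^ k) * mulMonomial p k w l := by
  have hlp : l.Coprime p :=
    Nat.Coprime.coprime_dvd_left hl ((Nat.coprime_self_sub_left hp.out.one_le).2
      (Nat.coprime_one_left p))
  have ha' : orderOf (a : ZMod (p ^ k)) = l * p ^ w := by rw [orderOf_units, ha]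
  have hu : IsUnit ((a : ZMod (p ^ k)) - 1) := by
    refine (isUnit_or_natCast_dvd _).resolve_right fun h => ?_
    have h2 : orderOf (a : ZMod (p ^ k)) ∣ p ^ (k - 1) := by
      rw [(geomSumRegular_of_odd hp.out hp2 h).orderOf_eq, ← natCast_pow_dvd_iff, pow_one]
      exact h
    rw [ha'] at h2
    exact hl1.ne' ((hlp.pow_right (k - 1)).eq_one_of_dvd ((dvd_mul_right _ _).trans h2))
  obtain ⟨q, hq⟩ := hl
  rw [Finset.sum_congr rfl (g := fun _ => mulMonomial p k w l), Finset.sum_const, Finset.card_univ,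
    ZMod.card, nsmul_eq_mul]
  · simp
  · intro b _
    obtain ⟨t, rfl⟩ := hu.dvd (a := b)
    exact cycleTypeMonomial_affinePerm_eq_mulMonomial (by omega) hq.symm hw a t
      fun x j d hj hx => pow_mul_eq_iff_of_orderOf_eq hp2 hlp ha' hj hx d

/-- The unit group is cyclic of order `(p - 1) * p ^ (k - 1)` with coprime factors, so each order is
uniquely `l * p ^ w`. -/
theorem sum_units_orderOf {M : Type*} [AddCommMonoid M] (hp2 : p ≠ 2) (hk : k ≠ 0)
    (F : (ZMod (p ^ k))ˣ → M) (f : ℕ → ℕ → M)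
    (h : ∀ a, ∀ w < k, ∀ l, l ∣ p - 1 → orderOf a = l * p ^ w → F a = f w l) :
    ∑ a, F a = ∑ w ∈ Finset.range k, ∑ l ∈ (p - 1).divisors,
      (Nat.totient (p ^ w) * Nat.totient l) • f w l := by
  have := ZMod.isCyclic_units_of_prime_pow p hp.out hp2 k
  have hcard : Fintype.card (ZMod (p ^ k))ˣ = (p - 1) * p ^ (k - 1) := by
    rw [ZMod.card_units_eq_totient, Nat.totient_prime_pow hp.out (Nat.pos_of_ne_zero hk), mul_comm]
  have hcop : (p - 1).Coprime p :=
    (Nat.coprime_self_sub_left hp.out.one_le).2 (Nat.coprime_one_left p)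
  have hcop' := hcop.pow_right (k - 1)
  have hmem : ∀ q ∈ Finset.range k ×ˢ (p - 1).divisors,
      (q.2, p ^ q.1) ∈ (p - 1).divisors ×ˢ (p ^ (k - 1)).divisors := fun q hq => by
    simp only [Finset.mem_product, Finset.mem_range] at hq ⊢
    exact ⟨hq.2, (Nat.mem_divisors_prime_pow hp.out _).2 ⟨q.1, by omega, rfl⟩⟩
  rw [← Finset.sum_product', ← Finset.sum_fiberwise_of_maps_to (g := orderOf)
    (t := ((p - 1) * p ^ (k - 1)).divisors)]
  · symm
    refine Finset.sum_bij (fun q _ => q.2 * p ^ q.1) ?_ ?_ ?_ ?_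
    · intro q hq
      rw [Nat.divisors_mul]
      have := Finset.mem_product.1 (hmem q hq)
      exact Finset.mul_mem_mul this.1 this.2
    · intro q hq q' hq' hqq
      have := hcop'.mul_injOn_divisors (hmem q hq) (hmem q' hq') hqq
      rw [Prod.mk.injEq] at this
      exact Prod.ext (Nat.pow_right_injective hp.out.two_le this.2) this.1
    · intro d hd
      rw [Nat.divisors_mul, Finset.mem_mul] at hd
      obtain ⟨l, hl, e, he, rfl⟩ := hd
      obtain ⟨w, hw, rfl⟩ := (Nat.mem_divisors_prime_pow hp.out _).1 he
      exact ⟨(w, l), Finset.mem_product.2 ⟨Finset.mem_range.2 (by omega), hl⟩, rfl⟩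
    · rintro ⟨w, l⟩ hq
      simp only [Finset.mem_product, Finset.mem_range, Nat.mem_divisors] at hq
      have hlp : l.Coprime p := hcop.coprime_dvd_left hq.2.1
      have hdvd : l * p ^ w ∣ Fintype.card (ZMod (p ^ k))ˣ := by
        rw [hcard]
        exact mul_dvd_mul hq.2.1 (pow_dvd_pow p (by omega))
      rw [Finset.sum_congr rfl (g := fun _ => f w l), Finset.sum_const,
        IsCyclic.card_orderOf_eq_totient hdvd, Nat.totient_mul (hlp.pow_right w), mul_comm]
      intro a ha
      exact h a w hq.1 l hq.2.1 (Finset.mem_filter.1 ha).2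
  · intro a _
    rw [Nat.mem_divisors, ← hcard]
    exact ⟨orderOf_dvd_card, Fintype.card_ne_zero⟩

theorem sum_range_totient_prime_pow (w : ℕ) :
    ∑ i ∈ Finset.range (w + 1), Nat.totient (p ^ i) = p ^ w := by
  rw [← Nat.sum_divisors_prime_pow (f := Nat.totient) hp.out, Nat.sum_totient]

theorem cycleIndex_holomorph_zmod_prime_pow (hp2 : p ≠ 2) (hk : 1 ≤ k) :
    cycleIndex (holomorph (ZMod (p ^ k))) =
        C (1 / ((p : ℚ) ^ (2 * k - 1) * ((p : ℚ) - 1))) *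
          (∑ w ∈ Finset.Icc 1 k,
              C ((p : ℚ) ^ (2 * w - 2) * ((p : ℚ) - 1)) * X (p ^ w) ^ (p ^ (k - w)) +
            ∑ w ∈ Finset.Icc 0 (k - 1),
              C ((Nat.totient (p ^ w) : ℚ) * (p : ℚ) ^ w) *
                (X 1 ^ (p ^ (k - w)) *
                  ∏ u ∈ Finset.Icc 1 w, X (p ^ u) ^ (p ^ (k - w - 1) * (p - 1))) +
            ∑ w ∈ Finset.Icc 0 (k - 1), ∑ l ∈ (p - 1).divisors with 1 < l,
              C ((p : ℚ) ^ k * (Nat.totient (p ^ w) : ℚ) * (Nat.totient l : ℚ)) *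
                (X 1 * X l ^ ((p ^ (k - w) - 1) / l) *
                  ∏ u ∈ Finset.Icc 1 w,
                    X (l * p ^ u) ^ (p ^ (k - 1 - w) * (p - 1) / l))) := by
  have hp0 : p - 1 ≠ 0 := by have := hp.out.two_le; omega
  have hcast : ((p - 1 : ℕ) : ℚ) = p - 1 := by
    rw [Nat.cast_sub hp.out.one_le, Nat.cast_one]
  have hrange : Finset.Icc 0 (k - 1) = Finset.range k := by
    rw [Finset.range_eq_Ico]
    ext; simp only [Finset.mem_Icc, Finset.mem_Ico]; omega
  rw [cycleIndex_holomorph_zmod]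
  congr 2
  · congr 2
    rw [Nat.totient_prime_pow hp.out hk, ← hcast]
    push_cast
    have : 2 * k - 1 = (k - 1) + k := by omega
    rw [this, pow_add]
    ring
  · rw [sum_units_orderOf hp2 (by omega) _ (fun w l => if l = 1 then
      C ((p : ℚ) ^ w) * mulMonomial p k w 1 + ∑ j ∈ Finset.Icc (w + 1) k,
        C (Nat.totient (p ^ j) : ℚ) * X (p ^ j) ^ p ^ (k - j)
      else C ((p : ℚ) ^ k) * mulMonomial p k w l), hrange]
    · have hsplit : ∀ f : ℕ → MvPolynomial ℕ ℚ, ∑ l ∈ (p - 1).divisors, f l =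
          f 1 + ∑ l ∈ (p - 1).divisors with 1 < l, f l := fun f => by
        rw [← Finset.add_sum_erase _ _ (Nat.one_mem_divisors.2 hp0)]
        congr 2
        ext l
        simp only [Finset.mem_erase, Finset.mem_filter, Nat.mem_divisors]
        constructor
        · rintro ⟨h1, h2, h3⟩
          have : l ≠ 0 := by rintro rfl; exact h3 (zero_dvd_iff.1 h2)
          exact ⟨⟨h2, h3⟩, by omega⟩
        · rintro ⟨h1, h2⟩
          exact ⟨by omega, h1⟩
      simp only [hsplit]
      rw [Finset.sum_add_distrib]
      congr 1
      · simp only [if_true, Nat.totient_one, mul_one, smul_add, Finset.sum_add_distrib]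
        rw [add_comm]
        congr 1
        · simp only [Finset.smul_sum]
          -- The length `p ^ j` arises from every `w < j`; the totients of `p ^ w` add up to `p ^ (j
          -- - 1)`, giving the coefficient `p ^ (2 * j - 2) * (p - 1)`.
          rw [Finset.sum_comm' (t' := Finset.Icc 1 k) (s' := fun j => Finset.range j)]
          · refine Finset.sum_congr rfl fun j hj => ?_
            rw [Finset.mem_Icc] at hj
            obtain ⟨i, rfl⟩ := Nat.exists_eq_add_of_le' hj.1
            rw [← Finset.sum_smul, sum_range_totient_prime_pow, nsmul_eq_mul, ← mul_assoc,
              Nat.totient_prime_pow_succ hp.out, ← hcast]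
            congr 1
            have : 2 * (i + 1) - 2 = i + i := by omega
            rw [this, pow_add]
            push_cast
            simp only [map_mul, map_pow, map_natCast]
            ring
          · intro w j
            simp only [Finset.mem_range, Finset.mem_Icc]
            omega
        · refine Finset.sum_congr rfl fun w _ => ?_
          rw [mulMonomial_one hp.out.pos, nsmul_eq_mul, map_mul, ← mul_assoc, map_natCast]
      · refine Finset.sum_congr rfl fun w _ => Finset.sum_congr rfl fun l hl => ?_
        rw [if_neg (Finset.mem_filter.1 hl).2.ne', mulMonomial, nsmul_eq_mul, ← mul_assoc]
        congr 1
        simp only [map_mul, map_natCast, map_pow]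
        push_cast
        ring
    · intro a w hw l hl ha
      split_ifs with h1
      · subst h1
        have ha' : orderOf (a : ZMod (p ^ k)) = p ^ w := by rw [orderOf_units, ha, one_mul]
        have hgood := geomSumRegular_of_odd hp.out hp2
          (natCast_dvd_sub_one_of_pow_eq_one (a := (a : ZMod (p ^ k))) (by omega)
            (by rw [← ha', pow_orderOf_eq_one]))
        exact hgood.sum_cycleTypeMonomial hw (by rw [← hgood.orderOf_eq, ha'])
      · refine sum_cycleTypeMonomial_of_orderOf_eq hp2 hl ?_ hw ha
        have : l ≠ 0 := by rintro rfl; exact hp0 (zero_dvd_iff.1 hl)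
        omega

end PrimePow

/-! ### Powers of two: units congruent to 1 and to 3 modulo 4 -/

section Two

variable {k : ℕ}

theorem four_dvd_iff_addOrderOf_dvd {x : ZMod (2 ^ k)} :
    4 ∣ x ↔ addOrderOf x ∣ 2 ^ (k - 2) := by
  rw [← natCast_pow_dvd_iff (p := 2)]
  norm_num

/-- Multiplication by `2 ^ (k - 1)` serves as a parity test below. -/
theorem two_pow_pred_mul_two_mul (hk : 1 ≤ k) (x : ZMod (2 ^ k)) : 2 ^ (k - 1) * (2 * x) = 0 := by
  rw [← mul_assoc, ← pow_succ, Nat.sub_add_cancel hk]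
  have := ZMod.natCast_self (2 ^ k)
  push_cast at this
  rw [this, zero_mul]

theorem two_pow_pred_ne_zero (hk : 1 ≤ k) : (2 : ZMod (2 ^ k)) ^ (k - 1) ≠ 0 := by
  intro h
  have h1 := addOrderOf_natCast_pow (p := 2) (k := k) (k - 1)
  rw [Nat.cast_ofNat, h, addOrderOf_zero, Nat.sub_sub_self hk] at h1
  norm_num at h1

theorem addOrderOf_eq_of_four_dvd_add_two (hk : 2 ≤ k) {x : ZMod (2 ^ k)} (h : 4 ∣ x + 2) :
    addOrderOf x = 2 ^ (k - 1) := by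
  obtain ⟨y, hy⟩ := h
  obtain rfl : x = 4 * y - 2 := by rw [← hy]; ring
  obtain ⟨m, rfl⟩ : ∃ m, k = m + 2 := ⟨k - 2, by omega⟩
  refine addOrderOf_eq_prime_pow ?_ ?_
  · have h1 : 2 ^ m • (4 * y - 2 : ZMod (2 ^ (m + 2))) =
        2 ^ (m + 2 - 1) * (2 * y) - 2 ^ (m + 2 - 1) := by
      rw [nsmul_eq_mul, Nat.add_one_sub_one]
      push_cast
      ring
    rw [h1, two_pow_pred_mul_two_mul (by omega), zero_sub, neg_eq_zero]
    exact two_pow_pred_ne_zero (by omega)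
  · have h1 : 2 ^ (m + 1) • (4 * y - 2 : ZMod (2 ^ (m + 2))) =
        2 ^ (m + 2 - 1) * (2 * (2 * y - 1)) := by
      rw [nsmul_eq_mul, Nat.add_one_sub_one]
      push_cast
      ring
    rw [h1, two_pow_pred_mul_two_mul (by omega)]

theorem four_dvd_sub_one_or_add_one (a : (ZMod (2 ^ k))ˣ) :
    (4 : ZMod (2 ^ k)) ∣ a - 1 ∨ (4 : ZMod (2 ^ k)) ∣ a + 1 := by
  obtain ⟨z, hz⟩ := ZMod.intCast_surjective (a : ZMod (2 ^ k))
  rcases Nat.eq_zero_or_pos k with rfl | hk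
  · exact Or.inl ⟨0, Subsingleton.elim (α := ZMod 1) _ _⟩
  have hodd : z % 2 = 1 := by
    by_contra h
    obtain ⟨y, rfl⟩ : 2 ∣ z := by omega
    have h1 := two_pow_pred_mul_two_mul hk (y * (a⁻¹ : (ZMod (2 ^ k))ˣ) : ZMod (2 ^ k))
    have h2 : (2 : ZMod (2 ^ k)) * (y * (a⁻¹ : (ZMod (2 ^ k))ˣ)) = 1 := by
      rw [← a.mul_inv, ← hz]
      push_cast
      ring
    rw [h2, mul_one] at h1
    exact two_pow_pred_ne_zero hk h1
  rw [← hz]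
  rcases (by omega : z % 4 = 1 ∨ z % 4 = 3) with h | h
  · obtain ⟨y, hy⟩ : 4 ∣ z - 1 := by omega
    exact Or.inl ⟨y, by exact_mod_cast congrArg (Int.cast : ℤ → ZMod (2 ^ k)) hy⟩
  · obtain ⟨y, hy⟩ : 4 ∣ z + 1 := by omega
    exact Or.inr ⟨y, by exact_mod_cast congrArg (Int.cast : ℤ → ZMod (2 ^ k)) hy⟩

theorem addOrderOf_sub_one_of_four_dvd_add_one (hk : 2 ≤ k) {a : ZMod (2 ^ k)} (h : 4 ∣ a + 1) :
    addOrderOf (a - 1) = 2 ^ (k - 1) :=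
  addOrderOf_eq_of_four_dvd_add_two hk (by ring_nf; rwa [add_comm])

theorem four_dvd_sq_sub_one {a : ZMod (2 ^ k)} (h : 4 ∣ a + 1) : 4 ∣ a ^ 2 - 1 :=
  h.trans ⟨a - 1, by ring⟩

/-- In `(a - 1) * (a + 1)` the first factor is twice an odd element. For `a = -1` truncation gives
order 1. -/
theorem addOrderOf_sq_sub_one (hk : 2 ≤ k) {a : ZMod (2 ^ k)} (h : 4 ∣ a + 1) {w : ℕ}
    (hw : addOrderOf (a + 1) = 2 ^ w) : addOrderOf (a ^ 2 - 1) = 2 ^ (w - 1) := by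
  have : a ^ 2 - 1 = (a - 1) * (a + 1) := by ring
  rw [this, addOrderOf_mul_eq (addOrderOf_sub_one_of_four_dvd_add_one hk h) hw]
  congr 1
  omega

/-- Even `d` reduce to the regular element `a ^ 2`. For odd `d`, `a ^ d - 1` is 2 modulo 4 and kills
only elements of order at most 2, excluded by `2 ≤ j`. -/
theorem pow_mul_eq_iff_of_four_dvd_add_one (hk : 2 ≤ k) {a : ZMod (2 ^ k)} (h : 4 ∣ a + 1) {w : ℕ}
    (hw : addOrderOf (a + 1) = 2 ^ w) {x : ZMod (2 ^ k)} {j : ℕ} (hj : 2 ≤ j)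
    (hx : addOrderOf x = 2 ^ j) (d : ℕ) :
    a ^ d * x = x ↔ 2 * 2 ^ (w - 1 + j - k) ∣ d := by
  have hsq := geomSumRegular_two (four_dvd_sq_sub_one h)
  have heven : ∀ e, a ^ (2 * e) * x = x ↔ 2 ^ (w - 1 + j - k) ∣ e := fun e => by
    rw [pow_mul, hsq.pow_mul_eq_iff, addOrderOf_mul_eq (addOrderOf_sq_sub_one hk h hw) hx]
  rcases Nat.even_or_odd' d with ⟨e, rfl | rfl⟩
  · rw [heven, Nat.mul_dvd_mul_iff_left two_pos]
  · refine iff_of_false (fun hd => ?_) (fun hd => ?_)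
    · have h4 : 4 ∣ (a ^ (2 * e + 1) - 1) + 2 := by
        have h1 : 4 ∣ (a ^ 2) ^ e - 1 :=
          (four_dvd_sq_sub_one h).trans (by simpa using sub_dvd_pow_sub_pow (a ^ 2) 1 e)
        have h2 : (a ^ (2 * e + 1) - 1) + 2 = ((a ^ 2) ^ e - 1) * a + (a + 1) := by ring
        rw [h2]
        exact dvd_add (h1.mul_right _) h
      have h0 := addOrderOf_mul_eq (addOrderOf_eq_of_four_dvd_add_two hk h4) hx
      rw [sub_mul, hd, one_mul, sub_self, addOrderOf_zero] at h0
      have := Nat.pow_eq_one.1 h0.symm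
      omega
    · have := (dvd_mul_right _ _).trans hd
      omega

/-- Pairing consecutive terms extracts a factor `a + 1` and leaves a geometric sum in `a ^ 2`; a sum
of an odd number of terms is odd. -/
theorem geom_sum_eq_zero_iff_of_four_dvd_add_one (hk : 2 ≤ k) {a : ZMod (2 ^ k)} (h : 4 ∣ a + 1)
    {w : ℕ} (hw : addOrderOf (a + 1) = 2 ^ w) (d : ℕ) :
    ∑ i ∈ Finset.range d, a ^ i = 0 ↔ 2 ^ (w + 1) ∣ d := by
  have hsq := geomSumRegular_two (four_dvd_sq_sub_one h)
  have heven : ∀ e, ∑ i ∈ Finset.range (2 * e), a ^ i =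
      (∑ i ∈ Finset.range e, (a ^ 2) ^ i) * (a + 1) := fun e => by
    induction e with
    | zero => simp
    | succ e ih =>
      rw [mul_add, mul_one, Finset.sum_range_succ, Finset.sum_range_succ, ih,
        Finset.sum_range_succ]
      ring
  rcases Nat.even_or_odd' d with ⟨e, rfl | rfl⟩
  · rw [heven, hsq, hw, pow_succ', Nat.mul_dvd_mul_iff_left two_pos]
  · refine iff_of_false (fun hd => ?_) (fun hd => ?_)
    · obtain ⟨y, hy⟩ := h
      rw [geom_sum_succ, heven, hy] at hd
      have h1 := congrArg (fun z => (2 : ZMod (2 ^ k)) ^ (k - 1) * z) hd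
      have h2 : (2 : ZMod (2 ^ k)) ^ (k - 1) *
          (a * ((∑ i ∈ Finset.range e, (a ^ 2) ^ i) * (4 * y)) + 1) =
          2 ^ (k - 1) * (2 * (2 * a * (∑ i ∈ Finset.range e, (a ^ 2) ^ i) * y)) +
            2 ^ (k - 1) := by ring
      simp only [h2, two_pow_pred_mul_two_mul (by omega : 1 ≤ k), zero_add, mul_zero] at h1
      exact two_pow_pred_ne_zero (by omega) h1
    · have := (dvd_pow_self 2 w.succ_ne_zero).trans hd
      omega

/-- The monomial `x₁ ^ 2 * x₂ ^ (2 ^ (k - 1 - v) - 1) * ∏ x_{2 ^ u} ^ (2 ^ (k - 2 - v))` with `u`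
ranging over `2, …, v + 1`: the cycle type of the multiplication by an element `a` of
`ZMod (2 ^ k)` with `a ≡ 3` modulo `4` and `a ^ 2` of order `2 ^ v`. -/
noncomputable def negMulMonomial (k v : ℕ) : MvPolynomial ℕ ℚ :=
  X 1 ^ 2 * X 2 ^ (2 ^ (k - 1 - v) - 1) *
    ∏ u ∈ Finset.Icc 2 (v + 1), X (2 ^ u) ^ (2 ^ (k - 2 - v))

theorem prod_range_eq_negMulMonomial {v : ℕ} (hv : v + 2 ≤ k) :
    ∏ j ∈ Finset.range (k + 1),
      (X (if j < 2 then 1 else 2 * 2 ^ (v + j - k)) : MvPolynomial ℕ ℚ) ^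
      (if j < 2 then 1 else 2 ^ (j - 2 - (v + j - k))) = negMulMonomial k v := by
  obtain ⟨m, rfl⟩ : ∃ m, k = 1 + (m + 1 + v) := ⟨k - 2 - v, by omega⟩
  have h1 : 1 + (m + 1 + v) + 1 = 2 + (m + 1 + v) := by omega
  rw [negMulMonomial, h1, Finset.prod_range_add, Finset.prod_range_add,
    prod_Icc_two_eq_prod_range, ← mul_assoc]
  congr 1
  · congr 1
    · simp [Finset.prod_range_succ, sq]
    · have h2 : ∀ i ∈ Finset.range (m + 1),
          (X (if 2 + i < 2 then 1 else 2 * 2 ^ (v + (2 + i) - (1 + (m + 1 + v)))) :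
            MvPolynomial ℕ ℚ) ^
          (if 2 + i < 2 then 1 else 2 ^ (2 + i - 2 - (v + (2 + i) - (1 + (m + 1 + v))))) =
          X 2 ^ 2 ^ i := fun i hi => by
        rw [Finset.mem_range] at hi
        have h3 : v + (2 + i) - (1 + (m + 1 + v)) = 0 := by omega
        rw [if_neg (by omega), if_neg (by omega), h3]
        simp
      rw [Finset.prod_congr rfl h2, Finset.prod_pow_eq_pow_sum, Nat.geomSum_eq le_rfl]
      congr 1
      have : 1 + (m + 1 + v) - 1 - v = m + 1 := by omega
      rw [this]
      simp
  · refine Finset.prod_congr rfl fun i hi => ?_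
    rw [Finset.mem_range] at hi
    have h3 : v + (2 + (m + 1 + i)) - (1 + (m + 1 + v)) = i + 1 := by omega
    have h4 : 2 + (m + 1 + i) - 2 - (i + 1) = m := by omega
    have h5 : 1 + (m + 1 + v) - 2 - v = m := by omega
    rw [if_neg (by omega), if_neg (by omega), ← pow_succ', h3, h4, h5]

theorem le_of_four_dvd {x : ZMod (2 ^ k)} (h : 4 ∣ x) {w : ℕ} (hw : addOrderOf x = 2 ^ w) :
    w ≤ k - 2 := by
  rwa [four_dvd_iff_addOrderOf_dvd, hw, Nat.pow_dvd_pow_iff_le_right one_lt_two] at h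

theorem cycleTypeMonomial_affinePerm_eq_negMulMonomial (hk : 2 ≤ k) {a : (ZMod (2 ^ k))ˣ}
    (h : (4 : ZMod (2 ^ k)) ∣ a + 1) {w : ℕ} (hw : addOrderOf ((a : ZMod (2 ^ k)) + 1) = 2 ^ w)
    (t : ZMod (2 ^ k)) :
    cycleTypeMonomial (affinePerm a ((a - 1) * t)) = negMulMonomial k (w - 1) := by
  have hwk := le_of_four_dvd h hw
  rw [← prod_range_eq_negMulMonomial (by omega)]
  refine cycleTypeMonomial_affinePerm_mul (p := 2) a t _ _ (fun x j d hx => ?_) fun j hj => ?_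
  · split_ifs with hj
    · have h1 := addOrderOf_mul_eq (addOrderOf_sub_one_of_four_dvd_add_one hk h) hx
      rw [(by omega : k - 1 + j - k = 0), pow_zero, AddMonoid.addOrderOf_eq_one_iff] at h1
      rw [← sub_eq_zero, ← sub_one_mul, ← geom_sum_mul, mul_assoc, h1]
      simp
    · exact pow_mul_eq_iff_of_four_dvd_add_one hk h hw (by omega) hx d
  · split_ifs with hj2
    · interval_cases j <;> simp
    · rw [Nat.totient_prime_pow Nat.prime_two (by omega), ← pow_succ', ← pow_add]
      norm_num
      omega

/-- For odd `b` each displacement `(a - 1) * x + b` is a unit, so the geometric sum itself must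
vanish. -/
theorem cycleTypeMonomial_affinePerm_of_addOrderOf_eq (hk : 2 ≤ k) {a : (ZMod (2 ^ k))ˣ}
    (h : (4 : ZMod (2 ^ k)) ∣ a + 1) {w : ℕ} (hw : addOrderOf ((a : ZMod (2 ^ k)) + 1) = 2 ^ w)
    {b : ZMod (2 ^ k)} (hb : addOrderOf b = 2 ^ k) :
    cycleTypeMonomial (affinePerm a b) = X (2 ^ (w + 1)) ^ 2 ^ (k - (w + 1)) := by
  have hwk := le_of_four_dvd h hw
  refine cycleTypeMonomial_eq_pow _ _ _ (fun x d => ?_) (by positivity) (by positivity) ?_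
  · have hy : addOrderOf (((a : ZMod (2 ^ k)) - 1) * x + b) = 2 ^ k := by
      refine (addOrderOf_mul_add (p := 2) ?_ x).trans hb
      rw [hb, addOrderOf_sub_one_of_four_dvd_add_one hk h,
        Nat.pow_dvd_pow_iff_le_right one_lt_two]
      omega
    rw [affinePerm_pow_apply_eq_iff, (isUnit_of_addOrderOf_eq hy).mul_left_eq_zero,
      geom_sum_eq_zero_iff_of_four_dvd_add_one hk h hw]
  · rw [ZMod.card, ← pow_add]
    congr 1
    omega

theorem sum_cycleTypeMonomial_of_four_dvd_add_one (hk : 2 ≤ k) {a : (ZMod (2 ^ k))ˣ}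
    (h : (4 : ZMod (2 ^ k)) ∣ a + 1) {w : ℕ}
    (hw : addOrderOf ((a : ZMod (2 ^ k)) + 1) = 2 ^ w) :
    ∑ b, cycleTypeMonomial (affinePerm a b) = C ((2 : ℚ) ^ (k - 1)) *
      (negMulMonomial k (w - 1) + X (2 ^ (w + 1)) ^ 2 ^ (k - (w + 1))) := by
  have key : ∀ b, cycleTypeMonomial (affinePerm a b) =
      if addOrderOf b ∣ 2 ^ (k - 1) then negMulMonomial k (w - 1) else
        X (2 ^ (w + 1)) ^ 2 ^ (k - (w + 1)) := fun b => by
    split_ifs with hb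
    · rw [← addOrderOf_sub_one_of_four_dvd_add_one hk h] at hb
      obtain ⟨t, rfl⟩ := dvd_of_addOrderOf_dvd (p := 2) hb
      exact cycleTypeMonomial_affinePerm_eq_negMulMonomial hk h hw t
    · refine cycleTypeMonomial_affinePerm_of_addOrderOf_eq hk h hw ?_
      obtain ⟨j, hj, hbj⟩ := exists_addOrderOf_eq_pow (p := 2) b
      rw [hbj, Nat.pow_dvd_pow_iff_le_right one_lt_two] at hb
      rw [hbj, (by omega : j = k)]
  rw [Finset.sum_congr rfl fun b _ => key b, sum_addOrderOf (p := 2) fun d => if d ∣ 2 ^ (k - 1)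
    then negMulMonomial k (w - 1) else X (2 ^ (w + 1)) ^ 2 ^ (k - (w + 1)), Finset.sum_range_succ,
    if_neg, Finset.sum_congr rfl (g := fun j => Nat.totient (2 ^ j) • negMulMonomial k (w - 1)),
    ← Finset.sum_smul, Nat.totient_prime_pow Nat.prime_two (by omega)]
  · obtain ⟨m, rfl⟩ : ∃ m, k = m + 1 := ⟨k - 1, by omega⟩
    rw [sum_range_totient_prime_pow, nsmul_eq_mul, nsmul_eq_mul]
    simp [mul_add, (map_ofNat C 2 : (C 2 : MvPolynomial ℕ ℚ) = 2)]
  · intro j hj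
    rw [Finset.mem_range] at hj
    rw [if_pos (pow_dvd_pow 2 (by omega))]
  · rw [Nat.pow_dvd_pow_iff_le_right one_lt_two]
    omega

/-- As `w < k`, adding an element of order `2 ^ w` to `e` always gives a unit. -/
theorem card_filter_addOrderOf_sub {w : ℕ} (hw : w < k) (e : (ZMod (2 ^ k))ˣ) :
    (Finset.univ.filter fun a : (ZMod (2 ^ k))ˣ =>
      addOrderOf ((a : ZMod (2 ^ k)) - e) = 2 ^ w).card = Nat.totient (2 ^ w) := by
  rw [← card_filter_addOrderOf (p := 2) hw.le]
  refine Finset.card_bij (fun a _ => (a : ZMod (2 ^ k)) - e) ?_ ?_ ?_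
  · intro a ha
    simpa using ha
  · intro a _ a' _ h
    exact Units.ext (sub_left_injective h)
  · intro c hc
    rw [Finset.mem_filter] at hc
    have hu : IsUnit (c + e) := by
      refine isUnit_of_addOrderOf_eq (p := 2) ?_
      have he : addOrderOf (e : ZMod (2 ^ k)) = 2 ^ k := by
        rw [← one_mul (e : ZMod (2 ^ k)), addOrderOf_mul_unit, ZMod.addOrderOf_one]
      have h := addOrderOf_mul_add (p := 2) (b := (e : ZMod (2 ^ k))) (c := c) ?_ 1
      · rwa [mul_one, he] at h
      · rw [he, hc.2, Nat.pow_dvd_pow_iff_le_right one_lt_two]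
        omega
    exact ⟨hu.unit, by simpa using hc.2, by simp⟩

theorem sum_filter_addOrderOf_sub {M : Type*} [AddCommMonoid M] (hk : 2 ≤ k) (e : (ZMod (2 ^ k))ˣ)
    (F : (ZMod (2 ^ k))ˣ → M) (f : ℕ → M)
    (h : ∀ a : (ZMod (2 ^ k))ˣ, (4 : ZMod (2 ^ k)) ∣ a - e →
      ∀ w, addOrderOf ((a : ZMod (2 ^ k)) - e) = 2 ^ w → F a = f w) :
    ∑ a ∈ Finset.univ.filter fun a : (ZMod (2 ^ k))ˣ =>
      addOrderOf ((a : ZMod (2 ^ k)) - e) ∣ 2 ^ (k - 2), F a =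
      ∑ w ∈ Finset.range (k - 1), Nat.totient (2 ^ w) • f w := by
  have hr : k - 1 = k - 2 + 1 := by omega
  rw [hr, ← Nat.sum_divisors_prime_pow (f := fun d => Nat.totient d • f (padicValNat 2 d))
    Nat.prime_two |>.trans (Finset.sum_congr rfl fun w _ => by rw [padicValNat.prime_pow]),
    ← Finset.sum_fiberwise_of_maps_to
      (g := fun a : (ZMod (2 ^ k))ˣ => addOrderOf ((a : ZMod (2 ^ k)) - e))
      (t := (2 ^ (k - 2)).divisors)]
  · refine Finset.sum_congr rfl fun d hd => ?_
    obtain ⟨w, hw, rfl⟩ := (Nat.mem_divisors_prime_pow Nat.prime_two _).1 hd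
    rw [Finset.filter_filter, padicValNat.prime_pow,
      ← card_filter_addOrderOf_sub (by omega : w < k) e, ← Finset.sum_const]
    refine Finset.sum_congr ?_ fun a ha => ?_
    · ext a
      simp only [Finset.mem_filter, Finset.mem_univ, true_and, and_iff_right_iff_imp]
      intro ha
      rw [ha]
      exact pow_dvd_pow 2 hw
    · have ha' := (Finset.mem_filter.1 ha).2
      refine h a ?_ w ha'
      rw [four_dvd_iff_addOrderOf_dvd, ha']
      exact pow_dvd_pow 2 hw
  · intro a ha
    exact Nat.mem_divisors.2 ⟨(Finset.mem_filter.1 ha).2, by positivity⟩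

theorem sum_units_two_pow {M : Type*} [AddCommMonoid M] (hk : 2 ≤ k)
    (F : (ZMod (2 ^ k))ˣ → M) (f g : ℕ → M)
    (hf : ∀ a : (ZMod (2 ^ k))ˣ, (4 : ZMod (2 ^ k)) ∣ a - 1 →
      ∀ w, addOrderOf ((a : ZMod (2 ^ k)) - 1) = 2 ^ w → F a = f w)
    (hg : ∀ a : (ZMod (2 ^ k))ˣ, (4 : ZMod (2 ^ k)) ∣ a + 1 →
      ∀ w, addOrderOf ((a : ZMod (2 ^ k)) + 1) = 2 ^ w → F a = g w) :
    ∑ a, F a = ∑ w ∈ Finset.range (k - 1), Nat.totient (2 ^ w) • f w +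
      ∑ w ∈ Finset.range (k - 1), Nat.totient (2 ^ w) • g w := by
  have h1 := sum_filter_addOrderOf_sub hk 1 F f (by simpa using hf)
  have h2 := sum_filter_addOrderOf_sub hk (-1) F g (by simpa using hg)
  rw [← h1, ← h2, ← Finset.sum_filter_add_sum_filter_not Finset.univ
    fun a : (ZMod (2 ^ k))ˣ => addOrderOf ((a : ZMod (2 ^ k)) - (1 : (ZMod (2 ^ k))ˣ)) ∣
      2 ^ (k - 2)]
  congr 1
  refine Finset.sum_congr ?_ fun _ _ => rfl
  ext a
  simp only [Finset.mem_filter, Finset.mem_univ, true_and, Units.val_one, Units.val_neg,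
    sub_neg_eq_add, ← four_dvd_iff_addOrderOf_dvd]
  refine ⟨(four_dvd_sub_one_or_add_one a).resolve_left, fun h h' => ?_⟩
  have h3 := addOrderOf_sub_one_of_four_dvd_add_one hk h
  have := le_of_four_dvd h' h3
  omega

theorem sum_cycleTypeMonomial_two_pow (hk : 2 ≤ k) :
    ∑ a : (ZMod (2 ^ k))ˣ, ∑ b, cycleTypeMonomial (affinePerm a b) =
      ∑ w ∈ Finset.range (k - 1), Nat.totient (2 ^ w) • (C ((2 : ℚ) ^ w) * mulMonomial 2 k w 1 +
        ∑ j ∈ Finset.Icc (w + 1) k, C (Nat.totient (2 ^ j) : ℚ) * X (2 ^ j) ^ 2 ^ (k - j)) +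
      ∑ w ∈ Finset.range (k - 1), Nat.totient (2 ^ w) • (C ((2 : ℚ) ^ (k - 1)) *
        (negMulMonomial k (w - 1) + X (2 ^ (w + 1)) ^ 2 ^ (k - (w + 1)))) := by
  refine sum_units_two_pow hk _ _ _ (fun a ha w hw => ?_) fun a ha w hw => ?_
  · have := le_of_four_dvd ha hw
    exact_mod_cast (geomSumRegular_two ha).sum_cycleTypeMonomial (p := 2) (by omega : w < k) hw
  · exact sum_cycleTypeMonomial_of_four_dvd_add_one hk ha hw

end Two

/-! ### Cycle indices for powers of two -/

theorem cycleIndex_holomorph_zmod_two_pow {k : ℕ} (hk : 1 ≤ k) :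
    cycleIndex (holomorph (ZMod (2 ^ k))) = C (1 / (2 : ℚ) ^ (2 * k - 1)) *
      ∑ a : (ZMod (2 ^ k))ˣ, ∑ b, cycleTypeMonomial (affinePerm a b) := by
  rw [cycleIndex_holomorph_zmod, Nat.totient_prime_pow Nat.prime_two hk,
    (by omega : 2 * k - 1 = (k - 1) + k), pow_add]
  norm_num

theorem cycleIndex_holomorph_zmod_two :
    cycleIndex (holomorph (ZMod 2)) =
      C (1 / 2 : ℚ) * X 1 ^ 2 + C (1 / 2 : ℚ) * X 2 := by
  have h1 := cycleIndex_holomorph_zmod_two_pow le_rfl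
  have h2 : ∀ a : (ZMod (2 ^ 1))ˣ, ∑ b, cycleTypeMonomial (affinePerm a b) =
      X 1 ^ 2 + X 2 := fun a => by
    obtain rfl : a = 1 := Subsingleton.elim (α := (ZMod 2)ˣ) a 1
    have hgood : GeomSumRegular ((1 : (ZMod (2 ^ 1))ˣ) : ZMod (2 ^ 1)) :=
      geomSumRegular_two (by simp)
    rw [hgood.sum_cycleTypeMonomial (p := 2) (w := 0) one_pos (by simp)]
    simp [mulMonomial, sq]
  have hcard : Fintype.card (ZMod (2 ^ 1))ˣ = 1 := by
    rw [ZMod.card_units_eq_totient]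
    simp
  rw [Finset.sum_congr rfl fun a _ => h2 a, Finset.sum_const, Finset.card_univ, hcard] at h1
  refine h1.trans ?_
  norm_num
  ring

theorem cycleIndex_holomorph_zmod_four :
    cycleIndex (holomorph (ZMod 4)) =
      C (1 / 8 : ℚ) * X 1 ^ 4 + C (1 / 4 : ℚ) * (X 1 ^ 2 * X 2) +
        C (3 / 8 : ℚ) * X 2 ^ 2 + C (1 / 4 : ℚ) * X 4 := by
  have h1 := cycleIndex_holomorph_zmod_two_pow one_le_two
  refine h1.trans ?_
  have hIcc : Finset.Icc 1 2 = {1, 2} := rfl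
  have h4 : Nat.totient 4 = 2 := rfl
  have h38 : (C (3 / 8 : ℚ) : MvPolynomial ℕ ℚ) = C (1 / 8) * 3 := by
    rw [← map_ofNat C 3, ← C_mul]
    norm_num
  have h14 : (C (1 / 4 : ℚ) : MvPolynomial ℕ ℚ) = C (1 / 8) * 2 := by
    rw [← map_ofNat C 2, ← C_mul]
    norm_num
  rw [sum_cycleTypeMonomial_two_pow le_rfl, h38, h14]
  norm_num [mulMonomial, negMulMonomial, hIcc, h4]
  rw [(map_ofNat C 2 : (C 2 : MvPolynomial ℕ ℚ) = 2)]
  ring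

theorem totient_two_pow_succ (n : ℕ) : Nat.totient (2 ^ (n + 1)) = 2 ^ n := by
  simp [Nat.totient_prime_pow_succ Nat.prime_two]

theorem cycleIndex_holomorph_zmod_two_pow_of_three_le {k : ℕ} (hk : 3 ≤ k) :
    cycleIndex (holomorph (ZMod (2 ^ k))) =
        C (1 / (2 : ℚ) ^ (2 * k - 1)) *
          (C ((2 : ℚ) ^ (2 * k - 3)) * X (2 ^ k) +
            ∑ w ∈ Finset.Icc 1 (k - 1),
              C ((2 : ℚ) ^ (2 * w - 2) + (Nat.totient (2 ^ (w - 1)) : ℚ) * (2 : ℚ) ^ (k - 1)) *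
                X (2 ^ w) ^ (2 ^ (k - w)) +
            ∑ w ∈ Finset.Icc 0 (k - 2),
              C ((Nat.totient (2 ^ w) : ℚ) * (2 : ℚ) ^ w) *
                (X 1 ^ (2 ^ (k - w)) *
                  ∏ u ∈ Finset.Icc 1 w, X (2 ^ u) ^ (2 ^ (k - 1 - w))) +
            C ((2 : ℚ) ^ k) * (X 1 ^ 2 * X 2 ^ (2 ^ (k - 1) - 1)) +
            ∑ w ∈ Finset.Icc 2 (k - 2),
              C ((2 : ℚ) ^ (k + w - 2)) *
                (X 1 ^ 2 * X 2 ^ (2 ^ (k - w) - 1) *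
                  ∏ u ∈ Finset.Icc 2 w, X (2 ^ u) ^ (2 ^ (k - 1 - w)))) := by
  rw [cycleIndex_holomorph_zmod_two_pow (by omega), sum_cycleTypeMonomial_two_pow (by omega)]
  congr 1
  obtain ⟨m, rfl⟩ : ∃ m, k = m + 3 := ⟨k - 3, by omega⟩
  have hC2 : (C 2 : MvPolynomial ℕ ℚ) = 2 := map_ofNat C 2
  have hmul : ∑ w ∈ Finset.Icc 0 (m + 3 - 2), C ((Nat.totient (2 ^ w) : ℚ) * (2 : ℚ) ^ w) *
      (X 1 ^ (2 ^ (m + 3 - w)) * ∏ u ∈ Finset.Icc 1 w, X (2 ^ u) ^ (2 ^ (m + 3 - 1 - w))) =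
      ∑ w ∈ Finset.range (m + 3 - 1), Nat.totient (2 ^ w) •
        (C ((2 : ℚ) ^ w) * mulMonomial 2 (m + 3) w 1) := by
    refine Finset.sum_congr ?_ fun w _ => ?_
    · ext w
      simp only [Finset.mem_Icc, Finset.mem_range]
      omega
    · rw [mulMonomial_one two_pos, Nat.sub_right_comm, nsmul_eq_mul, map_mul, map_natCast,
        mul_assoc]
      norm_num
  have hfull : ∑ w ∈ Finset.range (m + 3 - 1), Nat.totient (2 ^ w) •
      ∑ j ∈ Finset.Icc (w + 1) (m + 3),
        C (Nat.totient (2 ^ j) : ℚ) * (X (2 ^ j) : MvPolynomial ℕ ℚ) ^ 2 ^ (m + 3 - j) =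
      ∑ j ∈ Finset.Icc 1 (m + 3 - 1), C ((2 : ℚ) ^ (2 * j - 2)) * X (2 ^ j) ^ 2 ^ (m + 3 - j) +
        C ((2 : ℚ) ^ (2 * (m + 3) - 3)) * X (2 ^ (m + 3)) := by
    simp only [Finset.smul_sum]
    -- Here `w` stops at `k - 2`, so the top index `j = k` collects only `2 ^ (k - 2)` units; hence
    -- its separate term.
    rw [Finset.sum_comm' (t' := Finset.Icc 1 (m + 3))
      (s' := fun j => Finset.range (min j (m + 2)))]
    · rw [Finset.sum_Icc_succ_top (by omega)]
      congr 1
      · refine Finset.sum_congr rfl fun j hj => ?_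
        rw [Finset.mem_Icc] at hj
        obtain ⟨i, rfl⟩ := Nat.exists_eq_add_of_le' hj.1
        rw [min_eq_left (by omega), ← Finset.sum_smul, sum_range_totient_prime_pow, nsmul_eq_mul,
          totient_two_pow_succ, ← mul_assoc, (by omega : 2 * (i + 1) - 2 = i + i), pow_add]
        simp [hC2, pow_add]
      · rw [min_eq_right (by omega), ← Finset.sum_smul, sum_range_totient_prime_pow, nsmul_eq_mul,
          totient_two_pow_succ, ← mul_assoc,
          (by omega : 2 * (m + 3) - 3 = (m + 1) + (m + 2)), pow_add _ (m + 1)]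
        simp [hC2]
    · intro w j
      simp only [Finset.mem_range, Finset.mem_Icc]
      omega
  have hodd : ∑ w ∈ Finset.range (m + 3 - 1), Nat.totient (2 ^ w) •
      (C ((2 : ℚ) ^ (m + 3 - 1)) * (X (2 ^ (w + 1)) : MvPolynomial ℕ ℚ) ^ 2 ^ (m + 3 - (w + 1))) =
      ∑ j ∈ Finset.Icc 1 (m + 3 - 1), C ((Nat.totient (2 ^ (j - 1)) : ℚ) * (2 : ℚ) ^ (m + 3 - 1)) *
        X (2 ^ j) ^ 2 ^ (m + 3 - j) := by
    rw [sum_Icc_one_eq_sum_range]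
    refine Finset.sum_congr rfl fun w _ => ?_
    rw [Nat.add_sub_cancel, map_mul, map_natCast, nsmul_eq_mul, mul_assoc]
  have hneg : ∑ w ∈ Finset.range (m + 3 - 1), Nat.totient (2 ^ w) •
      (C ((2 : ℚ) ^ (m + 3 - 1)) * negMulMonomial (m + 3) (w - 1)) =
      C ((2 : ℚ) ^ (m + 3)) * (X 1 ^ 2 * X 2 ^ (2 ^ (m + 3 - 1) - 1)) +
      ∑ w ∈ Finset.Icc 2 (m + 3 - 2), C ((2 : ℚ) ^ (m + 3 + w - 2)) *
        (X 1 ^ 2 * X 2 ^ (2 ^ (m + 3 - w) - 1) *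
          ∏ u ∈ Finset.Icc 2 w, X (2 ^ u) ^ (2 ^ (m + 3 - 1 - w))) := by
    -- The terms `w = 0` and `w = 1` both have `w - 1 = 0`, hence the same monomial; together they
    -- give the coefficient `2 ^ k`.
    rw [show m + 3 - 1 = m + 1 + 1 from rfl, Finset.sum_range_succ', Finset.sum_range_succ',
      show m + 3 - 2 = m + 1 from rfl, sum_Icc_two_eq_sum_range, add_comm, add_comm (∑ i ∈ _, _),
      ← add_assoc]
    congr 1
    · simp only [negMulMonomial, map_pow, hC2]
      simp
      ring
    · refine Finset.sum_congr rfl fun i _ => ?_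
      rw [totient_two_pow_succ, negMulMonomial, nsmul_eq_mul, ← mul_assoc,
        (by omega : m + 3 + (i + 2) - 2 = (i + 1) + (m + 1 + 1)), pow_add _ (i + 1), map_mul,
        (by omega : m + 3 - 1 - (i + 1 + 1 - 1) = m + 3 - (i + 2)),
        (by omega : m + 3 - 2 - (i + 1 + 1 - 1) = m + 1 + 1 - (i + 2))]
      simp [hC2]
  rw [hmul]
  simp only [mul_add, smul_add, Finset.sum_add_distrib, map_add, add_mul] at hfull hodd hneg ⊢
  rw [hfull, hodd, hneg]
  ring

theorem mainTheorem4 :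
    (∀ (p k : ℕ) [Fact p.Prime], p ≠ 2 → 1 ≤ k →
      cycleIndex (holomorph (ZMod (p ^ k))) =
        C (1 / ((p : ℚ) ^ (2 * k - 1) * ((p : ℚ) - 1))) *
          (∑ w ∈ Finset.Icc 1 k,
              C ((p : ℚ) ^ (2 * w - 2) * ((p : ℚ) - 1)) * X (p ^ w) ^ (p ^ (k - w)) +
            ∑ w ∈ Finset.Icc 0 (k - 1),
              C ((Nat.totient (p ^ w) : ℚ) * (p : ℚ) ^ w) *
                (X 1 ^ (p ^ (k - w)) *
                  ∏ u ∈ Finset.Icc 1 w, X (p ^ u) ^ (p ^ (k - w - 1) * (p - 1))) +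
            ∑ w ∈ Finset.Icc 0 (k - 1), ∑ l ∈ (p - 1).divisors with 1 < l,
              C ((p : ℚ) ^ k * (Nat.totient (p ^ w) : ℚ) * (Nat.totient l : ℚ)) *
                (X 1 * X l ^ ((p ^ (k - w) - 1) / l) *
                  ∏ u ∈ Finset.Icc 1 w,
                    X (l * p ^ u) ^ (p ^ (k - 1 - w) * (p - 1) / l)))) ∧
    cycleIndex (holomorph (ZMod 2)) =
      C (1 / 2 : ℚ) * X 1 ^ 2 + C (1 / 2 : ℚ) * X 2 ∧
    cycleIndex (holomorph (ZMod 4)) =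
      C (1 / 8 : ℚ) * X 1 ^ 4 + C (1 / 4 : ℚ) * (X 1 ^ 2 * X 2) +
        C (3 / 8 : ℚ) * X 2 ^ 2 + C (1 / 4 : ℚ) * X 4 ∧
    (∀ k : ℕ, 3 ≤ k →
      cycleIndex (holomorph (ZMod (2 ^ k))) =
        C (1 / (2 : ℚ) ^ (2 * k - 1)) *
          (C ((2 : ℚ) ^ (2 * k - 3)) * X (2 ^ k) +
            ∑ w ∈ Finset.Icc 1 (k - 1),
              C ((2 : ℚ) ^ (2 * w - 2) + (Nat.totient (2 ^ (w - 1)) : ℚ) * (2 : ℚ) ^ (k - 1)) *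
                X (2 ^ w) ^ (2 ^ (k - w)) +
            ∑ w ∈ Finset.Icc 0 (k - 2),
              C ((Nat.totient (2 ^ w) : ℚ) * (2 : ℚ) ^ w) *
                (X 1 ^ (2 ^ (k - w)) *
                  ∏ u ∈ Finset.Icc 1 w, X (2 ^ u) ^ (2 ^ (k - 1 - w))) +
            C ((2 : ℚ) ^ k) * (X 1 ^ 2 * X 2 ^ (2 ^ (k - 1) - 1)) +
            ∑ w ∈ Finset.Icc 2 (k - 2),
              C ((2 : ℚ) ^ (k + w - 2)) *
                (X 1 ^ 2 * X 2 ^ (2 ^ (k - w) - 1) *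
                  ∏ u ∈ Finset.Icc 2 w, X (2 ^ u) ^ (2 ^ (k - 1 - w))))) := by
  exact ⟨fun p k _ hp hk => cycleIndex_holomorph_zmod_prime_pow hp hk,
    cycleIndex_holomorph_zmod_two, cycleIndex_holomorph_zmod_four,
    fun k hk => cycleIndex_holomorph_zmod_two_pow_of_three_le hk⟩
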